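/- For a strictly increasing sequence of integers $(a_n)_{n\ge 0}$ with $a_0\ge 2$, let $\tau_n\colon\{0,1\}^*\to\{0,1\}^*$ be the morphisms $$\tau_n(0)=011,\qquad \tau_n(1)=0^2\,1\,0^3\,1\cdots 0^{a_n}\,1\qquad(n\ge 0),$$ put $\tau_{[0,n]}=\tau_0\circ\tau_1\circ\cdots\circ\tau_n$, and let $X_{\boldsymbol\tau}\subseteq\{0,1\}^{\mathbb Z}$ be the subshift of all two-sided sequences each of whose finite subwords occurs in $\tau_{[0,n]}(b)$ for some $n\ge 0$ and some $b\in\{0,1\}$. Let $S$ be the shift and let $p_X(n)$ be the number of words of length $n$ occurring in points of a subshift $X$. A minimal Cantor system (a minimal homeomorphism of a Cantor set) has topological rank $k$ if $k$ is the least integer $d$ such that the system is topologically conjugate to the Bratteli-Vershik system $(X_B,V_B)$ of a simple, properly ordered Bratteli diagram $B$ with at most $d$ vertices at every level. Proposition. There is a strictly increasing sequence $(a_n)_{n\ge 0}$ with $a_0\ge 2$ and $$a_{n+1} > (3n+4)\,\frac{|\tau_{[0,n]}(1)|}{|\tau_{[0,n]}(0)|}\qquad\text{for all } n\ge 0,$$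 such that $X=X_{\boldsymbol\tau}$ is a minimal subshift, $(X,S)$ is a minimal Cantor system of topological rank $2$, and $$\liminf_{n\to+\infty}\frac{p_X(n)}{n}=+\infty,\qquad \lim_{n\to+\infty}\frac{p_X(n)}{n^2}=0 .$$ In particular there is a minimal subshift of topological rank $2$ whose complexity is superlinear, so finite topological rank does not imply non-superlinear complexity ($\liminf_{n} p_X(n)/n<+\infty$). -/

import Mathlib

open Filter Topology
open scoped ENNReal

/-! ## Minimal systems -/

/-- `(X, T)` is minimal: the orbit `{Tⁿ x : n ∈ ℤ}` of every point is dense. -/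
def IsMinimalSystem {X : Type*} [TopologicalSpace X] (T : X ≃ₜ X) : Prop :=
  ∀ x : X, Dense (Set.range fun n : ℤ => (T ^ n) x)

/-- `(X, T)` is a minimal Cantor system: `X` is a Cantor set (nonempty, compact, metrizable, totally
disconnected, without isolated points) and `T` is a minimal homeomorphism of it. -/
structure IsMinimalCantorSystem {X : Type*} [TopologicalSpace X] (T : X ≃ₜ X) : Prop where
  nonempty : Nonempty X
  compact : CompactSpace X
  metrizable : TopologicalSpace.MetrizableSpace X
  totallyDisconnected : TotallyDisconnectedSpace X
  perfect : PerfectSpace X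
  minimal : IsMinimalSystem T

/-! ## Subshifts -/

/-- The shift map `(S x)_n = x_{n+1}` on two-sided sequences. -/
def shiftMap (A : Type*) [TopologicalSpace A] : (ℤ → A) ≃ₜ (ℤ → A) where
  toFun x := fun n => x (n + 1)
  invFun x := fun n => x (n - 1)
  left_inv x := by funext n; simp
  right_inv x := by funext n; simp
  continuous_toFun := continuous_pi fun n => continuous_apply (n + 1)
  continuous_invFun := continuous_pi fun n => continuous_apply (n - 1)

/-- A subshift over the (finite, discrete) alphabet `A`: a closed shift-invariant set. -/
structure Subshift (A : Type*) [TopologicalSpace A] where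
  carrier : Set (ℤ → A)
  isClosed : IsClosed carrier
  shift_mem_iff : ∀ x, x ∈ carrier ↔ shiftMap A x ∈ carrier

/-- The word `x_{[m, m + l)}`. -/
def factorAt {A : Type*} (x : ℤ → A) (m : ℤ) (l : ℕ) : List A :=
  List.ofFn fun i : Fin l => x (m + (i : ℕ))

namespace Subshift

variable {A : Type*} [TopologicalSpace A]

/-- The shift, as a homeomorphism of the points of the subshift. -/
def shift (X : Subshift A) : X.carrier ≃ₜ X.carrier :=
  (shiftMap A).subtype X.shift_mem_iff

/-- The words of length `n` of the language of `X`. -/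
def wordsOfLength (X : Subshift A) (n : ℕ) : Set (List A) :=
  {w | ∃ x ∈ X.carrier, ∃ m : ℤ, w = factorAt x m n}

/-- The complexity function `p_X`. -/
noncomputable def complexity (X : Subshift A) (n : ℕ) : ℕ :=
  (X.wordsOfLength n).ncard

end Subshift

/-! ## Subshifts generated by a sequence of morphisms -/

section Sadic

variable {A : ℕ → Type*}

/-- `composedMorphism τ n k` is `τ_{[n, n+k)} = τ_n ∘ τ_{n+1} ∘ ⋯ ∘ τ_{n+k-1}`, on letters; a
morphism of free monoids is given by the images of the letters. -/
def composedMorphism (τ : ∀ n, A (n + 1) → List (A n)) (n : ℕ) : ∀ k : ℕ, A (n + k) → List (A n)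
  | 0 => fun a => [a]
  | k + 1 => fun a => (τ (n + k) a).flatMap (composedMorphism τ n k)

/-- The words occurring in `τ_{[n, N)}(a)` for some `N > n` and some letter `a`. -/
def sadicLanguage (τ : ∀ n, A (n + 1) → List (A n)) (n : ℕ) : Set (List (A n)) :=
  {w | ∃ k : ℕ, 0 < k ∧ ∃ a : A (n + k), w <:+: composedMorphism τ n k a}

/-- The subshift `X_τ^{(n)}` of all sequences all of whose words belong to the language of level
`n`; for `n = 0` it is the subshift `X_τ` generated by `τ`. -/
def sadicSubshift [∀ n, TopologicalSpace (A n)] [∀ n, DiscreteTopology (A n)]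
    (τ : ∀ n, A (n + 1) → List (A n)) (n : ℕ) : Subshift (A n) where
  carrier := {x | ∀ (m : ℤ) (l : ℕ), factorAt x m l ∈ sadicLanguage τ n}
  isClosed := by
    simp only [Set.ofPred_forall]
    refine isClosed_iInter fun m => isClosed_iInter fun l => ?_
    have hc : Continuous fun (x : ℤ → A n) (i : Fin l) => x (m + (i : ℕ)) :=
      continuous_pi fun i => continuous_apply _
    exact (isClosed_discrete {v : Fin l → A n | List.ofFn v ∈ sadicLanguage τ n}).preimage hc
  shift_mem_iff x := by
    have key : ∀ (m : ℤ) (l : ℕ), factorAt (shiftMap (A n) x) m l = factorAt x (m + 1) l := by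
      intro m l
      simp only [factorAt]
      congr 1
      funext i
      change x (m + (i : ℕ) + 1) = x (m + 1 + (i : ℕ))
      congr 1
      ring
    constructor
    · intro h m l
      rw [key]
      exact h (m + 1) l
    · intro h m l
      have := h (m - 1) l
      rwa [key, sub_add_cancel] at this

end Sadic

/-- The morphisms `τ_n(0) = 011`, `τ_n(1) = 0²1 0³1 ⋯ 0^{a_n}1` on the alphabet `{0, 1}`. -/
def exampleMorphism (a : ℕ → ℕ) (n : ℕ) (i : Fin 2) : List (Fin 2) :=
  if i = 0 then [0, 1, 1]
  else (List.range' 2 (a n - 1)).flatMap fun j => List.replicate j 0 ++ [1]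

/-- The subshift `X_τ` generated by the morphisms `exampleMorphism a`. -/
def exampleSubshift (a : ℕ → ℕ) : Subshift (Fin 2) :=
  sadicSubshift (A := fun _ => Fin 2) (exampleMorphism a) 0

/-! ## Ordered Bratteli diagrams and the Vershik map -/

/-- An ordered Bratteli diagram: finite levels `V n` of vertices, where `V 0` is a singleton; finite
sets `E n` of edges from `V n` to `V (n + 1)`; every vertex is the source of an edge, and every
vertex outside `V 0` is the range of an edge; two edges are comparable if and only if they have the
same range. -/
structure OrderedBratteliDiagram where
  V : ℕ → Type
  E : ℕ → Type
  finV : ∀ n, Finite (V n)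
  finE : ∀ n, Finite (E n)
  s : ∀ {n}, E n → V n
  r : ∀ {n}, E n → V (n + 1)
  card_V_zero : Nat.card (V 0) = 1
  s_surj : ∀ {n} (v : V n), ∃ e : E n, s e = v
  r_surj : ∀ {n} (v : V (n + 1)), ∃ e : E n, r e = v
  ord : ∀ n, PartialOrder (E n)
  comparable_iff : ∀ {n} (e f : E n), (e ≤ f ∨ f ≤ e) ↔ r e = r f

namespace OrderedBratteliDiagram

attribute [instance] finV finE ord

variable (B : OrderedBratteliDiagram)

/-- `B.Joined u v`: the vertices `u` and `v` are connected by a finite path (from `u` down to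
`v`). -/
inductive Joined {n : ℕ} (u : B.V n) : ∀ {m : ℕ}, B.V m → Prop
  | refl : Joined u u
  | step {m : ℕ} (e : B.E m) : Joined u (B.s e) → Joined u (B.r e)

/-- The diagram is simple (primitive). -/
def IsSimple : Prop :=
  ∀ n ≥ 1, ∃ N > n, ∀ (u : B.V n) (v : B.V N), B.Joined u v

/-- The space `X_B` of infinite paths starting at level `0`. -/
def PathSpace : Type :=
  {x : ∀ n, B.E n // ∀ n, B.r (x n) = B.s (x (n + 1))}

/-- The topology of `X_B` generated by the cylinder sets, that is, the one induced by the product of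
the discrete topologies on the sets of edges. -/
instance : TopologicalSpace B.PathSpace :=
  TopologicalSpace.induced Subtype.val (@Pi.topologicalSpace ℕ B.E fun _ => ⊥)

/-- There is exactly one path all of whose edges are maximal, and exactly one all of whose edges are
minimal. -/
def IsProperlyOrdered : Prop :=
  (∃! x : B.PathSpace, ∀ n, IsMax (x.1 n)) ∧ (∃! x : B.PathSpace, ∀ n, IsMin (x.1 n))

variable {B}

/-- The graph of the Vershik map: either `x` is the maximal path and `y` the minimal one, or, with
`x n` the first edge of `x` that is not maximal, `y n` is the successor of `x n`, the edges of `y`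
before `y n` are minimal, and `y` agrees with `x` after level `n`. -/
def IsVershikSucc (x y : B.PathSpace) : Prop :=
  ((∀ n, IsMax (x.1 n)) ∧ ∀ n, IsMin (y.1 n)) ∨
  ∃ n, (∀ m < n, IsMax (x.1 m)) ∧ ¬ IsMax (x.1 n) ∧
    x.1 n ⋖ y.1 n ∧ (∀ m < n, IsMin (y.1 m)) ∧ ∀ m > n, y.1 m = x.1 m

theorem eq_of_isMin {n : ℕ} {e f : B.E n} (he : IsMin e) (hf : IsMin f) (h : B.r e = B.r f) :
    e = f := by
  rcases (B.comparable_iff e f).2 h with h | h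
  · exact le_antisymm h (hf h)
  · exact le_antisymm (he h) h

theorem exists_isMin {n : ℕ} (v : B.V (n + 1)) : ∃ e : B.E n, B.r e = v ∧ IsMin e := by
  obtain ⟨e, he⟩ := B.r_surj v
  obtain ⟨f, hfe, hf⟩ := Set.Finite.exists_le_minimal (Set.toFinite (Set.univ : Set (B.E n)))
    (Set.mem_univ e)
  refine ⟨f, ?_, fun g hg => hf.2 (Set.mem_univ g) hg⟩
  rw [← he]
  exact (B.comparable_iff f e).1 (Or.inl hfe)

theorem exists_extend (x : ∀ m, B.E m) : ∀ (n : ℕ) (e : B.E n), ∃ z : ∀ m, B.E m,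
    z n = e ∧ (∀ m > n, z m = x m) ∧ ∀ m < n, IsMin (z m) ∧ B.r (z m) = B.s (z (m + 1)) := by
  intro n
  induction n with
  | zero =>
    intro e
    refine ⟨Function.update x 0 e, by simp, fun m hm => ?_, fun m hm => absurd hm (by omega)⟩
    rw [Function.update_of_ne (by omega)]
  | succ n ih =>
    intro e
    obtain ⟨f, hf, hmin⟩ := exists_isMin (B.s e)
    obtain ⟨z, hz, hzx, hzm⟩ := ih f
    refine ⟨Function.update z (n + 1) e, by simp, fun m hm => ?_, fun m hm => ?_⟩
    · rw [Function.update_of_ne (by omega)]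
      exact hzx m (by omega)
    · rw [Function.update_of_ne (by omega)]
      rcases Nat.lt_succ_iff_lt_or_eq.1 hm with h | rfl
      · rw [Function.update_of_ne (by omega)]
        exact hzm m h
      · rw [Function.update_self, hz]
        exact ⟨hmin, hf⟩

theorem exists_covBy {n : ℕ} {e : B.E n} (he : ¬ IsMax e) : ∃ f : B.E n, e ⋖ f := by
  obtain ⟨f, hf⟩ := not_isMax_iff.1 he
  obtain ⟨g, -, hg⟩ := Set.Finite.exists_le_minimal (Set.toFinite {g : B.E n | e < g}) hf
  exact ⟨g, hg.1, fun c hc hcg => hcg.not_ge (hg.2 hc hcg.le)⟩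

/-- In a properly ordered diagram the relation above is the graph of a map. -/
theorem existsUnique_isVershikSucc (hB : B.IsProperlyOrdered) (x : B.PathSpace) :
    ∃! y, IsVershikSucc x y := by
  classical
  by_cases hx : ∀ n, IsMax (x.1 n)
  · obtain ⟨y, hy, huniq⟩ := hB.2
    refine ⟨y, Or.inl ⟨hx, hy⟩, ?_⟩
    rintro z (⟨-, hz⟩ | ⟨n, -, hn, -⟩)
    · exact huniq z hz
    · exact absurd (hx n) hn
  · have hex : ∃ n, ¬ IsMax (x.1 n) := not_forall.1 hx
    obtain ⟨n, hn, hlt⟩ : ∃ n, ¬ IsMax (x.1 n) ∧ ∀ m < n, IsMax (x.1 m) :=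
      ⟨Nat.find hex, Nat.find_spec hex, fun m hm => not_not.1 (Nat.find_min hex hm)⟩
    obtain ⟨f, hf⟩ := exists_covBy hn
    have hfr : B.r f = B.r (x.1 n) := ((B.comparable_iff _ _).1 (Or.inl hf.le)).symm
    obtain ⟨z, hz, hzx, hzm⟩ := exists_extend x.1 n f
    refine ⟨⟨z, fun m => ?_⟩, Or.inr ⟨n, hlt, hn, ?_, fun m hm => (hzm m hm).1, hzx⟩, ?_⟩
    · rcases lt_trichotomy m n with h | rfl | h
      · exact (hzm m h).2
      · rw [hz, hfr, hzx _ (by omega)]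
        exact x.2 m
      · rw [hzx m h, hzx (m + 1) (by omega)]
        exact x.2 m
    · change x.1 n ⋖ z n
      rw [hz]
      exact hf
    · rintro y (⟨hmax, -⟩ | ⟨k, hkl, hk, hky, hkmin, hkx⟩)
      · exact absurd (hmax n) hn
      have hkn : k = n := by
        rcases lt_trichotomy k n with h | h | h
        · exact absurd (hlt k h) hk
        · exact h
        · exact absurd (hkl n h) hn
      subst hkn
      have hyk : y.1 k = z k := by
        rw [hz]
        have h1 : B.r (y.1 k) = B.r f := by
          rw [hfr]
          exact ((B.comparable_iff _ _).1 (Or.inl hky.le)).symm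
        rcases (B.comparable_iff _ _).2 h1 with h | h
        · exact h.eq_of_not_lt fun h' => hf.2 hky.lt h'
        · exact (h.eq_of_not_lt fun h' => hky.2 hf.lt h').symm
      have hdown : ∀ d ≤ k, y.1 (k - d) = z (k - d) := by
        intro d
        induction d with
        | zero => intro _; exact hyk
        | succ d ih =>
          intro hd
          have h1 := ih (by omega)
          have h2 : k - d = k - (d + 1) + 1 := by omega
          rw [h2] at h1
          have hlt' : k - (d + 1) < k := by omega
          refine eq_of_isMin (hkmin _ hlt') (hzm _ hlt').1 ?_
          rw [y.2, h1, (hzm _ hlt').2]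
      apply Subtype.ext
      funext m
      change y.1 m = z m
      rcases le_or_gt m k with h | h
      · have := hdown (k - m) (by omega)
        rwa [Nat.sub_sub_self h] at this
      · rw [hkx m h, hzx m h]

/-- The Vershik map `V_B` of a properly ordered diagram. -/
noncomputable def vershikMap (hB : B.IsProperlyOrdered) (x : B.PathSpace) : B.PathSpace :=
  (existsUnique_isVershikSucc hB x).choose

theorem isVershikSucc_vershikMap (hB : B.IsProperlyOrdered) (x : B.PathSpace) :
    IsVershikSucc x (vershikMap hB x) :=
  (existsUnique_isVershikSucc hB x).choose_spec.1

variable (B)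

/-- `B` is a Bratteli-Vershik representation of `(X, T)`: it is simple and properly ordered, and
`(X, T)` is topologically conjugate to `(X_B, V_B)`. -/
def IsRepresentationOf {X : Type*} [TopologicalSpace X] (T : X ≃ₜ X) : Prop :=
  B.IsSimple ∧ ∃ hB : B.IsProperlyOrdered,
    ∃ π : X ≃ₜ B.PathSpace, ∀ x, π (T x) = vershikMap hB (π x)

end OrderedBratteliDiagram

/-- `(X, T)` is a minimal Cantor system of topological rank `k`: the least `d` such that `(X, T)` has
a Bratteli-Vershik representation with at most `d` vertices at every level exists and is `k`. -/
def HasTopologicalRank {X : Type*} [TopologicalSpace X] (T : X ≃ₜ X) (k : ℕ) : Prop :=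
  IsMinimalCantorSystem T ∧
  IsLeast {d : ℕ | ∃ B : OrderedBratteliDiagram, B.IsRepresentationOf T ∧
    ∀ n, Nat.card (B.V n) ≤ d} k

/-! Write `w_n(b)` for `τ_{[0,n)}(b)`, `q_n` and `r_n` for the lengths of `w_n(0)` and `w_n(1)`, and
`p` for the complexity.

Rank: all images start with `0` and end with `1`, so the morphisms define a simple, properly ordered
diagram with at most two vertices per level. Its Vershik map acts like an odometer, and reading
vertex labels along orbits (`code`) maps the path space equivariantly into the subshift. This coding
is injective (`code_injective`): a block starts exactly where `1` is followed by `0*1`, its second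
letter identifies it, and the argument repeats on the desubstituted path `tail p`. It is onto
because its image is compact and contains a dense orbit (`codePoint_bijective`). Conversely, a
diagram with one vertex per level forces bounded complexity (`IsRepresentationOf.complexity_le`), so
superlinearity excludes rank one.

Lower bound: the words `w_n(0)^k w_n(1) w_n(0)^(k+1)` can be preceded by both `w_n(0)` and `w_n(1)`.
Prefixing the common suffix of these two words makes them left special, and about `l / (2 q_n)`
values of `k` give distinct left special words of length `l` (`complexity_succ_ge`) when `6 q_n ≤ l
≤ a_n q_n`. The required growth of `a_n` makes `l / q_(n+1)` at least `n` as soon as `l > a_n q_n`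
(for `n ≥ 1`), so the increments of `p` tend to infinity.

Upper bound: a word of length `l ≤ r_n` lies in some `w_n(1) w_n(0)^k w_n(1)` with `k ≤ l / q_n +
2`, which bounds `p(l)` by `(l / q_n + 3)(2 r_n + l + 2 q_n + 1)` (`complexity_le`). If `a_n` barely
exceeds what is required, then `a_n q_n ≤ (3n+9) r_n`, and for `r_n < l ≤ r_(n+1)` this yields `p(l)
/ l² ≤ 46 (3n+9)² / q_n` (`complexity_mul_le`). The right side tends to zero because `q_n ≥ 3^n`. -/

namespace OrderedBratteliDiagram

variable {B : OrderedBratteliDiagram}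

/-! ### The Vershik map as a homeomorphism -/

theorem covBy_unique {n : ℕ} {e f g : B.E n} (hf : e ⋖ f) (hg : e ⋖ g) : f = g := by
  have h1 : B.r f = B.r g := by
    rw [← (B.comparable_iff e f).1 (Or.inl hf.le), ← (B.comparable_iff e g).1 (Or.inl hg.le)]
  rcases (B.comparable_iff _ _).2 h1 with h | h
  · exact h.eq_of_not_lt fun h' => hg.2 hf.lt h'
  · exact (h.eq_of_not_lt fun h' => hf.2 hg.lt h').symm

/-- The successors of two paths that agree below `N` agree below `N`, unless all their edges below
`N` are minimal. -/
theorem IsVershikSucc.agree_or_isMin {x y x' y' : B.PathSpace} (hx : IsVershikSucc x x')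
    (hy : IsVershikSucc y y') {N : ℕ} (h : ∀ i < N, x.1 i = y.1 i) :
    (∀ i < N, x'.1 i = y'.1 i) ∨ ∀ i < N, IsMin (x'.1 i) ∧ IsMin (y'.1 i) := by
  by_cases hmax : ∀ i < N, IsMax (x.1 i)
  · right
    have key : ∀ {z z' : B.PathSpace}, IsVershikSucc z z' → (∀ i < N, IsMax (z.1 i)) →
        ∀ i < N, IsMin (z'.1 i) := by
      rintro z z' (⟨-, hz⟩ | ⟨n, -, hn, -, hz, -⟩) hm i hi
      · exact hz i
      · have : N ≤ n := not_lt.1 fun hlt => hn (hm n hlt)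
        exact hz i (by omega)
    exact fun i hi => ⟨key hx hmax i hi, key hy (fun j hj => h j hj ▸ hmax j hj) i hi⟩
  · left
    push Not at hmax
    obtain ⟨m, hmN, hm⟩ := hmax
    rcases hx with ⟨hx, -⟩ | ⟨n, hlt, hn, hcov, hmin, hgt⟩
    · exact absurd (hx m) hm
    rcases hy with ⟨hy, -⟩ | ⟨k, hlt', hn', hcov', hmin', hgt'⟩
    · exact absurd (h m hmN ▸ hy m) hm
    have hnN : n ≤ m := not_lt.1 fun hh => hm (hlt m hh)
    have hkn : k = n := by
      rcases lt_trichotomy k n with hh | hh | hh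
      · exact absurd (h k (by omega) ▸ hlt k hh) hn'
      · exact hh
      · exact absurd (h n (by omega) ▸ hlt' n hh) hn
    subst hkn
    -- Going down from the incremented edge, both successors consist of minimal edges, and a minimal
    -- edge is determined by its range.
    have hdown : ∀ d ≤ k, x'.1 (k - d) = y'.1 (k - d) := by
      intro d
      induction d with
      | zero =>
        intro _
        refine covBy_unique hcov ?_
        rw [h k (by omega)]
        exact hcov'
      | succ d ih =>
        intro hd
        have h1 := ih (by omega)
        have h2 : k - d = k - (d + 1) + 1 := by omega
        rw [h2] at h1
        refine eq_of_isMin (hmin _ (by omega)) (hmin' _ (by omega)) ?_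
        rw [x'.2, y'.2, h1]
    intro i hi
    rcases le_or_gt i k with hik | hik
    · have := hdown (k - i) (by omega)
      rwa [Nat.sub_sub_self hik] at this
    · rw [hgt i hik, hgt' i hik, h i hi]

variable (B) in
/-- The diagram with all orders reversed. -/
def reverse : OrderedBratteliDiagram where
  V := B.V
  E := B.E
  finV := B.finV
  finE := B.finE
  s := B.s
  r := B.r
  card_V_zero := B.card_V_zero
  s_surj := B.s_surj
  r_surj := B.r_surj
  ord n := inferInstanceAs (PartialOrder (B.E n)ᵒᵈ)
  comparable_iff e f := by
    rw [← B.comparable_iff e f, or_comm]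
    rfl

/-- Reversal exchanges minimal and maximal edges and turns covers around. This provides the inverse
of the Vershik map without a second construction. -/
theorem isVershikSucc_reverse {x y : B.PathSpace} :
    IsVershikSucc (B := B.reverse) y x ↔ IsVershikSucc x y := by
  have hmax : ∀ {n} (e : B.E n), @IsMax (B.reverse.E n) _ e ↔ IsMin e := fun _ => Iff.rfl
  have hmin : ∀ {n} (e : B.E n), @IsMin (B.reverse.E n) _ e ↔ IsMax e := fun _ => Iff.rfl
  have hcov : ∀ {n} (e f : B.E n), @CovBy (B.reverse.E n) _ e f ↔ f ⋖ e := fun e f =>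
    toDual_covBy_toDual_iff (a := f) (b := e)
  constructor
  · rintro (⟨h1, h2⟩ | ⟨n, h1, h2, h3, h4, h5⟩)
    · exact Or.inl ⟨h2, h1⟩
    · have h6 := (hcov _ _).1 h3
      exact Or.inr ⟨n, h4, not_isMax_of_lt h6.lt, h6, h1, fun m hm => (h5 m hm).symm⟩
  · rintro (⟨h1, h2⟩ | ⟨n, h1, h2, h3, h4, h5⟩)
    · exact Or.inl ⟨h2, h1⟩
    · exact Or.inr ⟨n, h4, fun h => not_isMin_of_lt h3.lt h, (hcov _ _).2 h3, h1,
        fun m hm => (h5 m hm).symm⟩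

theorem IsProperlyOrdered.reverse (hB : B.IsProperlyOrdered) : B.reverse.IsProperlyOrdered :=
  ⟨hB.2, hB.1⟩

/-- The Vershik map of a properly ordered diagram as a permutation of the path space. -/
noncomputable def vershikPerm (hB : B.IsProperlyOrdered) : Equiv.Perm B.PathSpace where
  toFun := vershikMap hB
  invFun := vershikMap (B := B.reverse) hB.reverse
  left_inv x := by
    have h1 := isVershikSucc_vershikMap hB x
    have h2 := isVershikSucc_vershikMap (B := B.reverse) hB.reverse (vershikMap (B := B) hB x)
    exact (existsUnique_isVershikSucc (B := B.reverse) hB.reverse (vershikMap (B := B) hB x)).unique h2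
      (isVershikSucc_reverse.2 h1)
  right_inv x := by
    have h1 := isVershikSucc_vershikMap (B := B.reverse) hB.reverse x
    have h2 := isVershikSucc_vershikMap hB (vershikMap (B := B.reverse) hB.reverse x)
    exact (existsUnique_isVershikSucc hB (vershikMap (B := B.reverse) hB.reverse x)).unique h2
      (isVershikSucc_reverse.1 h1)

theorem isOpen_agree (x : B.PathSpace) (N : ℕ) :
    IsOpen {y : B.PathSpace | ∀ i < N, y.1 i = x.1 i} := by
  let : ∀ n, TopologicalSpace (B.E n) := fun _ => ⊥
  have : ∀ n, DiscreteTopology (B.E n) := fun _ => ⟨rfl⟩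
  have : {y : B.PathSpace | ∀ i < N, y.1 i = x.1 i} =
      Subtype.val ⁻¹' (Set.pi (Set.Iio N) fun i => {x.1 i}) := by
    ext y
    exact Iff.rfl
  rw [this]
  exact (isOpen_set_pi (Set.finite_Iio N) fun i _ => isOpen_discrete _).preimage
    continuous_induced_dom

theorem exists_agree_subset {U : Set B.PathSpace} (hU : IsOpen U) {x : B.PathSpace} (hx : x ∈ U) :
    ∃ N, {y : B.PathSpace | ∀ i < N, y.1 i = x.1 i} ⊆ U := by
  let : ∀ n, TopologicalSpace (B.E n) := fun _ => ⊥
  have : ∀ n, DiscreteTopology (B.E n) := fun _ => ⟨rfl⟩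
  obtain ⟨W, hW, rfl⟩ := isOpen_induced_iff.1 hU
  obtain ⟨I, u, hI, hIW⟩ := isOpen_pi_iff.1 hW x.1 hx
  refine ⟨I.sup id + 1, fun y hy => hIW fun i hi => ?_⟩
  have : i ≤ I.sup id := Finset.le_sup (f := id) hi
  rw [hy i (by omega)]
  exact (hI i hi).2

instance : CompactSpace B.PathSpace := by
  let : ∀ n, TopologicalSpace (B.E n) := fun _ => ⊥
  have : ∀ n, DiscreteTopology (B.E n) := fun _ => ⟨rfl⟩
  let : ∀ n, TopologicalSpace (B.V n) := fun _ => ⊥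
  have : ∀ n, DiscreteTopology (B.V n) := fun _ => ⟨rfl⟩
  have hc : IsClosed {x : ∀ n, B.E n | ∀ n, B.r (x n) = B.s (x (n + 1))} := by
    simp only [Set.ofPred_forall]
    refine isClosed_iInter fun n => isClosed_eq ?_ ?_
    · exact continuous_of_discreteTopology.comp (continuous_apply n)
    · exact continuous_of_discreteTopology.comp (continuous_apply (n + 1))
  exact isCompact_iff_compactSpace.1 hc.isCompact

instance : T2Space B.PathSpace := by
  let : ∀ n, TopologicalSpace (B.E n) := fun _ => ⊥
  have : ∀ n, DiscreteTopology (B.E n) := fun _ => ⟨rfl⟩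
  exact inferInstanceAs (T2Space {x : ∀ n, B.E n // ∀ n, B.r (x n) = B.s (x (n + 1))})

/-- Trouble can only come from prefixes that are entirely maximal, whose images are entirely
minimal. If minimal edges of a level share their source, agreement is still forced one level below:
the range of each minimal edge is the source of the next one. -/
theorem continuous_vershikMap (hB : B.IsProperlyOrdered)
    (hs : ∀ {n} (e f : B.E (n + 1)), IsMin e → IsMin f → B.s e = B.s f) :
    Continuous (vershikMap hB) := by
  rw [continuous_def]
  intro U hU
  rw [isOpen_iff_mem_nhds]
  intro x hx
  obtain ⟨N, hN⟩ := exists_agree_subset hU hx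
  refine mem_of_superset ((isOpen_agree x (N + 1)).mem_nhds fun _ _ => rfl) fun y hy => hN ?_
  rcases (isVershikSucc_vershikMap hB y).agree_or_isMin (isVershikSucc_vershikMap hB x) hy with
    h | h
  · exact fun i hi => h i (by omega)
  · intro i hi
    refine eq_of_isMin (h i (by omega)).1 (h i (by omega)).2 ?_
    rw [(vershikMap hB y).2, (vershikMap (B := B) hB x).2]
    exact hs _ _ (h (i + 1) (by omega)).1 (h (i + 1) (by omega)).2

/-- The Vershik map as a homeomorphism, when all minimal edges of a level have the same source. -/
noncomputable def vershikHomeo (hB : B.IsProperlyOrdered)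
    (hs : ∀ {n} (e f : B.E (n + 1)), IsMin e → IsMin f → B.s e = B.s f) :
    B.PathSpace ≃ₜ B.PathSpace :=
  Continuous.homeoOfEquivCompactToT2 (f := vershikPerm hB) (continuous_vershikMap hB hs)

end OrderedBratteliDiagram

/-! ### The Bratteli diagram of a sequence of morphisms -/

/-- All images of letters are nonempty words starting with `0` and ending with `1`. -/
def IsProperSequence (τ : ℕ → Fin 2 → List (Fin 2)) : Prop :=
  ∀ n b, ∃ l, τ n b = 0 :: (l ++ [1])

/-- A position in a union of two towers of heights `L 0` and `L 1`. -/
@[ext]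
structure TowerFloor (L : Fin 2 → ℕ) where
  tower : Fin 2
  floor : ℕ
  lt : floor < L tower

namespace TowerFloor

variable {L : Fin 2 → ℕ}

instance : PartialOrder (TowerFloor L) where
  le e f := e.tower = f.tower ∧ e.floor ≤ f.floor
  le_refl e := ⟨rfl, le_rfl⟩
  le_trans e f g h h' := ⟨h.1.trans h'.1, h.2.trans h'.2⟩
  le_antisymm e f h h' := TowerFloor.ext h.1 (le_antisymm h.2 h'.2)

theorem le_iff {e f : TowerFloor L} : e ≤ f ↔ e.tower = f.tower ∧ e.floor ≤ f.floor := Iff.rfl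

theorem lt_iff {e f : TowerFloor L} : e < f ↔ e.tower = f.tower ∧ e.floor < f.floor := by
  rw [lt_iff_le_not_ge, le_iff, le_iff]
  constructor
  · rintro ⟨h1, h2⟩
    exact ⟨h1.1, not_le.1 fun h => h2 ⟨h1.1.symm, h⟩⟩
  · rintro ⟨h1, h2⟩
    exact ⟨⟨h1, h2.le⟩, fun h => absurd h.2 (not_le.2 h2)⟩

instance : Finite (TowerFloor L) := by
  refine Finite.of_injective
    (fun e : TowerFloor L => (⟨e.tower, e.floor, e.lt⟩ : Σ b : Fin 2, Fin (L b))) ?_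
  rintro ⟨b, i, hi⟩ ⟨c, j, hj⟩ h
  obtain ⟨rfl, h⟩ := Sigma.mk.inj_iff.1 h
  simpa using h

theorem isMin_iff {e : TowerFloor L} : IsMin e ↔ e.floor = 0 := by
  constructor
  · intro h
    have := h (b := ⟨e.tower, 0, by have := e.lt; omega⟩) ⟨rfl, Nat.zero_le _⟩
    exact Nat.le_zero.1 this.2
  · intro h f hf
    exact ⟨hf.1.symm, by omega⟩

theorem isMax_iff {e : TowerFloor L} : IsMax e ↔ e.floor + 1 = L e.tower := by
  have h0 := e.lt
  constructor
  · intro h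
    have := (h (b := ⟨e.tower, L e.tower - 1, by omega⟩) ⟨rfl, by simp only; omega⟩).2
    simp only at this
    omega
  · intro h f hf
    have := f.lt
    rw [← hf.1] at this
    exact ⟨hf.1.symm, by omega⟩

theorem covBy_iff {e f : TowerFloor L} : e ⋖ f ↔ e.tower = f.tower ∧ f.floor = e.floor + 1 := by
  constructor
  · rintro ⟨h1, h2⟩
    rw [lt_iff] at h1
    refine ⟨h1.1, ?_⟩
    by_contra hne
    have hf := f.lt
    have := @h2 ⟨e.tower, e.floor + 1, by rw [h1.1]; omega⟩ (lt_iff.2 ⟨rfl, by simp⟩)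
    exact this (lt_iff.2 ⟨h1.1, by simp only; omega⟩)
  · rintro ⟨h1, h2⟩
    refine ⟨lt_iff.2 ⟨h1, by omega⟩, fun g hg hg' => ?_⟩
    rw [lt_iff] at hg hg'
    omega

end TowerFloor

/-- The heights of the two towers at each level. -/
def towerHeight (τ : ℕ → Fin 2 → List (Fin 2)) : ℕ → Fin 2 → ℕ
  | 0, _ => 1
  | n + 1, b => (τ n b).length

/-- The source of an edge. -/
def edgeSource (τ : ℕ → Fin 2 → List (Fin 2)) :
    ∀ n, TowerFloor (towerHeight τ n) → (match n with | 0 => Unit | _ + 1 => Fin 2)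
  | 0, _ => ()
  | n + 1, e => (τ n e.tower)[e.floor]'e.lt

theorem IsProperSequence.exists_getElem {τ : ℕ → Fin 2 → List (Fin 2)} (hτ : IsProperSequence τ)
    (n : ℕ) (b c : Fin 2) : ∃ (i : ℕ) (hi : i < (τ n b).length), (τ n b)[i] = c := by
  refine List.mem_iff_getElem.1 ?_
  obtain ⟨l, hl⟩ := hτ n b
  rw [hl]
  fin_cases c <;> simp

/-- The ordered Bratteli diagram with two vertices at every level `n ≥ 1`, whose edges with range
`b` at level `n + 2` are ordered as the letters of `τ n b`. -/
def morphismDiagram (τ : ℕ → Fin 2 → List (Fin 2)) (hτ : IsProperSequence τ) :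
    OrderedBratteliDiagram where
  V n := match n with | 0 => Unit | _ + 1 => Fin 2
  E n := TowerFloor (towerHeight τ n)
  finV n := by cases n <;> (dsimp only; infer_instance)
  finE n := inferInstance
  s := edgeSource τ _
  r e := e.tower
  card_V_zero := by simp
  s_surj := by
    rintro (_ | n) v
    · exact ⟨⟨0, 0, Nat.one_pos⟩, rfl⟩
    · obtain ⟨i, hi, h⟩ := hτ.exists_getElem n 0 v
      exact ⟨⟨0, i, hi⟩, h⟩
  r_surj := by
    rintro n v
    refine ⟨⟨v, 0, ?_⟩, rfl⟩
    cases n with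
    | zero => exact Nat.one_pos
    | succ n =>
      obtain ⟨l, hl⟩ := hτ n v
      simp [towerHeight, hl]
  ord n := inferInstance
  comparable_iff e f := by
    constructor
    · rintro (h | h)
      · exact h.1
      · exact h.1.symm
    · intro h
      rcases le_total e.floor f.floor with h' | h'
      · exact Or.inl ⟨h, h'⟩
      · exact Or.inr ⟨h.symm, h'⟩

/-! ### Paths as labels and positions; the odometer action -/

namespace morphismDiagram

open OrderedBratteliDiagram

variable {τ : ℕ → Fin 2 → List (Fin 2)} {hτ : IsProperSequence τ}

/-- The vertex at level `n + 1` of a path. -/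
def label (p : (morphismDiagram τ hτ).PathSpace) (n : ℕ) : Fin 2 :=
  TowerFloor.tower (p.1 n)

/-- The rank of the edge at level `n + 1` of a path among the edges with the same range. -/
def pos (p : (morphismDiagram τ hτ).PathSpace) (n : ℕ) : ℕ :=
  TowerFloor.floor (p.1 (n + 1))

theorem getElem?_pos (p : (morphismDiagram τ hτ).PathSpace) (n : ℕ) :
    (τ n (label p (n + 1)))[pos p n]? = some (label p n) := by
  have h1 := TowerFloor.lt (p.1 (n + 1))
  have h2 := p.2 n
  exact (List.getElem?_eq_getElem h1).trans (congrArg some h2.symm)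

theorem pos_lt (p : (morphismDiagram τ hτ).PathSpace) (n : ℕ) :
    pos p n < (τ n (label p (n + 1))).length :=
  (List.getElem?_eq_some_iff.1 (getElem?_pos p n)).1

/-- The path with given vertices and edge ranks. -/
def mkPath (hτ : IsProperSequence τ) (b : ℕ → Fin 2) (i : ℕ → ℕ)
    (h : ∀ n, (τ n (b (n + 1)))[i n]? = some (b n)) : (morphismDiagram τ hτ).PathSpace :=
  ⟨fun n => match n with
    | 0 => ⟨b 0, 0, Nat.one_pos⟩
    | n + 1 => ⟨b (n + 1), i n, (List.getElem?_eq_some_iff.1 (h n)).1⟩,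
  fun n => by
    obtain ⟨h1, h2⟩ := List.getElem?_eq_some_iff.1 (h n)
    cases n <;> exact h2.symm⟩

@[simp]
theorem label_mkPath (b : ℕ → Fin 2) (i : ℕ → ℕ)
    (h : ∀ n, (τ n (b (n + 1)))[i n]? = some (b n)) (n : ℕ) : label (mkPath hτ b i h) n = b n := by
  cases n <;> rfl

@[simp]
theorem pos_mkPath (b : ℕ → Fin 2) (i : ℕ → ℕ)
    (h : ∀ n, (τ n (b (n + 1)))[i n]? = some (b n)) (n : ℕ) : pos (mkPath hτ b i h) n = i n := rfl

theorem edge_zero_ext {e f : (morphismDiagram τ hτ).E 0}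
    (h : TowerFloor.tower e = TowerFloor.tower f) : e = f := by
  have h1 : e.floor < 1 := e.lt
  have h2 : f.floor < 1 := f.lt
  exact TowerFloor.ext h (by omega)

theorem path_ext {p q : (morphismDiagram τ hτ).PathSpace} (h : ∀ n, label p n = label q n)
    (h' : ∀ n, pos p n = pos q n) : p = q := by
  apply Subtype.ext
  funext n
  cases n with
  | zero => exact edge_zero_ext (h 0)
  | succ n => exact TowerFloor.ext (h (n + 1)) (h' n)

theorem isMin_zero (e : (morphismDiagram τ hτ).E 0) : IsMin e :=
  TowerFloor.isMin_iff.2 (Nat.lt_one_iff.1 e.lt)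

theorem isMax_zero (e : (morphismDiagram τ hτ).E 0) : IsMax e :=
  TowerFloor.isMax_iff.2 (congrArg (· + 1) (Nat.lt_one_iff.1 e.lt))

theorem isMin_succ_iff (p : (morphismDiagram τ hτ).PathSpace) (n : ℕ) :
    IsMin (p.1 (n + 1)) ↔ pos p n = 0 := TowerFloor.isMin_iff

theorem isMax_succ_iff (p : (morphismDiagram τ hτ).PathSpace) (n : ℕ) :
    IsMax (p.1 (n + 1)) ↔ pos p n + 1 = (τ n (label p (n + 1))).length := TowerFloor.isMax_iff

theorem covBy_succ_iff (p q : (morphismDiagram τ hτ).PathSpace) (n : ℕ) :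
    p.1 (n + 1) ⋖ q.1 (n + 1) ↔ label p (n + 1) = label q (n + 1) ∧ pos q n = pos p n + 1 :=
  TowerFloor.covBy_iff

theorem eq_succ_iff (p q : (morphismDiagram τ hτ).PathSpace) (n : ℕ) :
    p.1 (n + 1) = q.1 (n + 1) ↔ label p (n + 1) = label q (n + 1) ∧ pos p n = pos q n :=
  TowerFloor.ext_iff

theorem forall_isMin_iff (p : (morphismDiagram τ hτ).PathSpace) :
    (∀ n, IsMin (p.1 n)) ↔ ∀ n, pos p n = 0 :=
  ⟨fun h n => (isMin_succ_iff p n).1 (h (n + 1)), fun h n => by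
    cases n with
    | zero => exact isMin_zero _
    | succ n => exact (isMin_succ_iff p n).2 (h n)⟩

theorem forall_isMax_iff (p : (morphismDiagram τ hτ).PathSpace) :
    (∀ n, IsMax (p.1 n)) ↔ ∀ n, pos p n + 1 = (τ n (label p (n + 1))).length :=
  ⟨fun h n => (isMax_succ_iff p n).1 (h (n + 1)), fun h n => by
    cases n with
    | zero => exact isMax_zero _
    | succ n => exact (isMax_succ_iff p n).2 (h n)⟩

theorem isVershikSucc_iff (p q : (morphismDiagram τ hτ).PathSpace) : IsVershikSucc p q ↔
    ((∀ n, pos p n + 1 = (τ n (label p (n + 1))).length) ∧ ∀ n, pos q n = 0) ∨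
    ∃ n, (∀ m < n, pos p m + 1 = (τ m (label p (m + 1))).length) ∧
      label p (n + 1) = label q (n + 1) ∧ pos q n = pos p n + 1 ∧ (∀ m < n, pos q m = 0) ∧
      ∀ m > n, label q (m + 1) = label p (m + 1) ∧ pos q m = pos p m := by
  rw [IsVershikSucc, forall_isMin_iff, forall_isMax_iff]
  refine or_congr Iff.rfl ⟨?_, ?_⟩
  · rintro ⟨n, h1, h2, h3, h4, h5⟩
    obtain _ | n := n
    · exact absurd (isMax_zero _) h2
    · rw [covBy_succ_iff] at h3
      exact ⟨n, fun m hm => (isMax_succ_iff p m).1 (h1 (m + 1) (by omega)), h3.1, h3.2,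
        fun m hm => (isMin_succ_iff q m).1 (h4 (m + 1) (by omega)),
        fun m hm => (eq_succ_iff q p m).1 (h5 (m + 1) (by omega))⟩
  · rintro ⟨n, h1, h2, h3, h4, h5⟩
    have hcov := (covBy_succ_iff p q n).2 ⟨h2, h3⟩
    refine ⟨n + 1, fun m hm => ?_, not_isMax_of_lt hcov.lt, hcov, fun m hm => ?_, fun m hm => ?_⟩
    · cases m with
      | zero => exact isMax_zero _
      | succ m => exact (isMax_succ_iff p m).2 (h1 m (by omega))
    · cases m with
      | zero => exact isMin_zero _
      | succ m => exact (isMin_succ_iff q m).2 (h4 m (by omega))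
    · obtain _ | m := m
      · omega
      · exact (eq_succ_iff q p m).2 (h5 m (by omega))

theorem label_of_pos_eq_zero (p : (morphismDiagram τ hτ).PathSpace) {n : ℕ} (h : pos p n = 0) :
    label p n = 0 := by
  have := getElem?_pos p n
  obtain ⟨l, hl⟩ := hτ n (label p (n + 1))
  rw [h, hl] at this
  simpa using this.symm

theorem label_of_pos_eq_last (p : (morphismDiagram τ hτ).PathSpace) {n : ℕ}
    (h : pos p n + 1 = (τ n (label p (n + 1))).length) : label p n = 1 := by
  have h2 := getElem?_pos p n
  obtain ⟨l, hl⟩ := hτ n (label p (n + 1))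
  have h3 : pos p n = l.length + 1 := by
    rw [hl] at h
    simpa using h
  rw [h3, hl] at h2
  simpa using h2.symm

variable (hτ) in
-- A maximal edge has as source the last letter of an image, which is always `1`; a minimal edge has
-- the first letter, always `0`. Hence the vertices of an extremal path, and with them its edges,
-- are determined.
theorem isProperlyOrdered : (morphismDiagram τ hτ).IsProperlyOrdered := by
  constructor
  · refine ⟨mkPath hτ (fun _ => 1) (fun n => (τ n 1).length - 1) fun n => ?_, ?_, ?_⟩
    · obtain ⟨l, hl⟩ := hτ n 1
      simp [hl]
    · refine (forall_isMax_iff _).2 fun n => ?_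
      obtain ⟨l, hl⟩ := hτ n 1
      simp [hl]
    · intro q hq
      replace hq := (forall_isMax_iff _).1 hq
      have hl : ∀ n, label q n = 1 := fun n => label_of_pos_eq_last q (hq n)
      refine path_ext (by simpa using hl) fun n => ?_
      have := hq n
      rw [hl] at this
      simp only [pos_mkPath]
      omega
  · refine ⟨mkPath hτ (fun _ => 0) (fun n => 0) fun n => ?_, ?_, ?_⟩
    · obtain ⟨l, hl⟩ := hτ n 0
      simp [hl]
    · exact (forall_isMin_iff _).2 (by simp)
    · intro q hq
      replace hq := (forall_isMin_iff _).1 hq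
      exact path_ext (by simpa using fun n => label_of_pos_eq_zero q (hq n)) (by simpa using hq)

variable (hτ) in
-- Both letters occur in every image, so consecutive levels are already completely connected.
theorem isSimple : (morphismDiagram τ hτ).IsSimple := by
  rintro (_ | n) hn
  · omega
  refine ⟨n + 2, by omega, fun u v => ?_⟩
  obtain ⟨i, hi, h⟩ := hτ.exists_getElem n v u
  have hs : (morphismDiagram τ hτ).s (n := n + 1) ⟨v, i, hi⟩ = u := h
  exact OrderedBratteliDiagram.Joined.step (B := morphismDiagram τ hτ) (u := u) (m := n + 1)
    ⟨v, i, hi⟩ (hs ▸ OrderedBratteliDiagram.Joined.refl)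

variable (hτ) in
theorem card_vertices_le (n : ℕ) : Nat.card ((morphismDiagram τ hτ).V n) ≤ 2 := by
  cases n with
  | zero => exact ((morphismDiagram τ hτ).card_V_zero).trans_le (by norm_num)
  | succ n => exact (Nat.card_fin 2).le

variable (hτ) in
/-- The Vershik map of the diagram. -/
noncomputable def vershik : (morphismDiagram τ hτ).PathSpace ≃ₜ (morphismDiagram τ hτ).PathSpace :=
  vershikHomeo (B := morphismDiagram τ hτ) (isProperlyOrdered hτ) fun {n} e f he hf => by
    have key : ∀ e : (morphismDiagram τ hτ).E (n + 1), IsMin e →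
        (morphismDiagram τ hτ).s e = (0 : Fin 2) := by
      intro e he
      have h0 : e.floor = 0 := TowerFloor.isMin_iff.1 he
      obtain ⟨l, hl⟩ := hτ n e.tower
      change (τ n e.tower)[e.floor]'e.lt = 0
      simp [h0, hl]
    exact (key e he).trans (key f hf).symm

theorem isVershikSucc_vershik (p : (morphismDiagram τ hτ).PathSpace) :
    IsVershikSucc p (vershik hτ p) := isVershikSucc_vershikMap (isProperlyOrdered hτ) p

theorem tail_proper (hτ : IsProperSequence τ) : IsProperSequence fun n => τ (n + 1) :=
  fun n b => hτ (n + 1) b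

/-- The path with its first edges deleted. -/
def tail (p : (morphismDiagram τ hτ).PathSpace) :
    (morphismDiagram (fun n => τ (n + 1)) (tail_proper hτ)).PathSpace :=
  mkPath _ (fun n => label p (n + 1)) (fun n => pos p (n + 1)) fun n => getElem?_pos p (n + 1)

@[simp]
theorem label_tail (p : (morphismDiagram τ hτ).PathSpace) (n : ℕ) :
    label (tail p) n = label p (n + 1) := by simp [tail]

@[simp]
theorem pos_tail (p : (morphismDiagram τ hτ).PathSpace) (n : ℕ) :
    pos (tail p) n = pos p (n + 1) := by simp [tail]

/-- The only datum lost in the tail besides the first position is the first label, and that is the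
letter found at this position in the image of the next label. -/
theorem tail_ext {p q : (morphismDiagram τ hτ).PathSpace} (h : tail p = tail q)
    (h' : pos p 0 = pos q 0) : p = q := by
  have h1 : ∀ n, label p (n + 1) = label q (n + 1) := fun n => by
    rw [← label_tail, ← label_tail, h]
  refine path_ext (fun n => ?_) fun n => ?_
  · cases n with
    | zero =>
      have h2 := getElem?_pos p 0
      rw [h1, h', getElem?_pos q 0] at h2
      exact (Option.some.inj h2).symm
    | succ n => exact h1 n
  · cases n with
    | zero => exact h'
    | succ n => rw [← pos_tail, ← pos_tail, h]

/-- A path beginning at the bottom of the tower determined by its tail. -/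
theorem exists_tail_eq (hτ : IsProperSequence τ)
    (P : (morphismDiagram (fun n => τ (n + 1)) (tail_proper hτ)).PathSpace) :
    ∃ p : (morphismDiagram τ hτ).PathSpace, tail p = P ∧ pos p 0 = 0 := by
  refine ⟨mkPath hτ (fun n => Nat.casesOn n 0 fun n => label P n)
    (fun n => Nat.casesOn n 0 fun n => pos P n) fun n => ?_, ?_, ?_⟩
  · cases n with
    | zero =>
      obtain ⟨l, hl⟩ := hτ 0 (label P 0)
      simp [hl]
    | succ n => exact getElem?_pos P n
  · exact path_ext (fun n => by simp) fun n => by simp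
  · simp

theorem IsVershikSucc.within {p q : (morphismDiagram τ hτ).PathSpace} (h : IsVershikSucc p q)
    (hp : pos p 0 + 1 < (τ 0 (label p 1)).length) : pos q 0 = pos p 0 + 1 ∧ tail q = tail p := by
  rcases (isVershikSucc_iff p q).1 h with ⟨h1, -⟩ | ⟨n, h1, h2, h3, h4, h5⟩
  · have := h1 0
    simp only [zero_add] at this
    omega
  · obtain _ | n := n
    · refine ⟨h3, path_ext (fun n => ?_) fun n => ?_⟩
      · rw [label_tail, label_tail]
        cases n with
        | zero => exact h2.symm
        | succ n => exact (h5 (n + 1) (by omega)).1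
      · rw [pos_tail, pos_tail]
        exact (h5 (n + 1) (by omega)).2
    · have := h1 0 (by omega)
      simp only [zero_add] at this
      omega

/-- Together with `IsVershikSucc.within` this is the odometer rule: below the top of a block only
the position moves; at the top it resets and the tail takes one step in the diagram of the shifted
sequence. -/
theorem IsVershikSucc.carry {p q : (morphismDiagram τ hτ).PathSpace} (h : IsVershikSucc p q)
    (hp : pos p 0 + 1 = (τ 0 (label p 1)).length) :
    pos q 0 = 0 ∧ IsVershikSucc (tail p) (tail q) := by
  rw [isVershikSucc_iff]
  simp only [label_tail, pos_tail]
  rcases (isVershikSucc_iff p q).1 h with ⟨h1, h1'⟩ | ⟨n, h1, h2, h3, h4, h5⟩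
  · exact ⟨h1' 0, Or.inl ⟨fun n => h1 (n + 1), fun n => h1' (n + 1)⟩⟩
  · obtain _ | n := n
    · have := pos_lt q 0
      rw [← h2, h3] at this
      simp only [zero_add] at this
      omega
    · exact ⟨h4 0 (by omega), Or.inr ⟨n, fun m hm => h1 (m + 1) (by omega), h2, h3,
        fun m hm => h4 (m + 1) (by omega), fun m hm => h5 (m + 1) (by omega)⟩⟩

end morphismDiagram

/-- `iterateMorphism τ k b` is `τ 0 ∘ τ 1 ∘ ⋯ ∘ τ (k - 1)` applied to the letter `b`. -/
def iterateMorphism (τ : ℕ → Fin 2 → List (Fin 2)) : ℕ → Fin 2 → List (Fin 2)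
  | 0, b => [b]
  | k + 1, b => (iterateMorphism (fun n => τ (n + 1)) k b).flatMap (τ 0)

/-- The definition splits off the first morphism, which suits induction through `tail`; this form
splits off the last one, as `composedMorphism` does. -/
theorem iterateMorphism_succ' (τ : ℕ → Fin 2 → List (Fin 2)) (k : ℕ) (b : Fin 2) :
    iterateMorphism τ (k + 1) b = (τ k b).flatMap (iterateMorphism τ k) := by
  induction k generalizing τ with
  | zero => simp [iterateMorphism]
  | succ k ih =>
    rw [iterateMorphism, ih, List.flatMap_assoc]
    rfl

theorem iterateMorphism_eq_composedMorphism (τ : ℕ → Fin 2 → List (Fin 2)) (k : ℕ) (b : Fin 2) :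
    iterateMorphism τ k b = composedMorphism (A := fun _ => Fin 2) τ 0 k b := by
  induction k generalizing b with
  | zero => rfl
  | succ k ih =>
    rw [iterateMorphism_succ', composedMorphism, Nat.zero_add]
    exact List.flatMap_congr fun c _ => ih c

/-! ### Words read along orbits -/

namespace morphismDiagram

open OrderedBratteliDiagram

variable {τ : ℕ → Fin 2 → List (Fin 2)} {hτ : IsProperSequence τ}

/-- The labels along the first `l` points of the forward orbit of a path. -/
noncomputable def word (p : (morphismDiagram τ hτ).PathSpace) (l : ℕ) : List (Fin 2) :=
  (List.range l).map fun t => label ((vershik hτ)^[t] p) 0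

@[simp]
theorem length_word (p : (morphismDiagram τ hτ).PathSpace) (l : ℕ) : (word p l).length = l := by
  simp [word]

theorem word_add (p : (morphismDiagram τ hτ).PathSpace) (k l : ℕ) :
    word p (k + l) = word p k ++ word ((vershik hτ)^[k] p) l := by
  simp [word, List.range_add, Function.comp_def, ← Function.iterate_add_apply, add_comm]

theorem word_one (p : (morphismDiagram τ hτ).PathSpace) : word p 1 = [label p 0] := by
  simp [word]

theorem tail_vershik {p : (morphismDiagram τ hτ).PathSpace}
    (hp : pos p 0 + 1 = (τ 0 (label p 1)).length) :
    pos (vershik hτ p) 0 = 0 ∧ tail (vershik hτ p) = vershik (tail_proper hτ) (tail p) := by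
  obtain ⟨h1, h2⟩ := IsVershikSucc.carry (isVershikSucc_vershik p) hp
  exact ⟨h1, (existsUnique_isVershikSucc (isProperlyOrdered (tail_proper hτ)) _).unique h2
    (isVershikSucc_vershik (tail p))⟩

theorem label_one_eq_of_tail {p q : (morphismDiagram τ hτ).PathSpace} (h : tail p = tail q) :
    label p 1 = label q 1 := by
  have := label_tail p 0
  rw [h, label_tail] at this
  exact this.symm

theorem iterate_within (p : (morphismDiagram τ hτ).PathSpace) (j : ℕ)
    (hj : pos p 0 + j < (τ 0 (label p 1)).length) :
    pos ((vershik hτ)^[j] p) 0 = pos p 0 + j ∧ tail ((vershik hτ)^[j] p) = tail p := by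
  induction j with
  | zero => simp
  | succ j ih =>
    obtain ⟨h1, h2⟩ := ih (by omega)
    rw [Function.iterate_succ_apply']
    have h3 := IsVershikSucc.within (isVershikSucc_vershik ((vershik hτ)^[j] p))
      (by rw [h1, label_one_eq_of_tail h2]; omega)
    rw [h1, h2] at h3
    exact ⟨by omega, h3.2⟩

theorem iterate_block {p : (morphismDiagram τ hτ).PathSpace} (hp : pos p 0 = 0) :
    pos ((vershik hτ)^[(τ 0 (label p 1)).length] p) 0 = 0 ∧
      tail ((vershik hτ)^[(τ 0 (label p 1)).length] p) = vershik (tail_proper hτ) (tail p) := by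
  have h0 := pos_lt p 0
  rw [zero_add, hp] at h0
  obtain ⟨n, hn⟩ : ∃ n, (τ 0 (label p 1)).length = n + 1 := ⟨_, (Nat.succ_pred_eq_of_pos h0).symm⟩
  obtain ⟨h1, h2⟩ := iterate_within p n (by omega)
  rw [hn, Function.iterate_succ_apply']
  have h3 := tail_vershik (p := (vershik hτ)^[n] p)
    (by rw [h1, label_one_eq_of_tail h2]; omega)
  rwa [h2] at h3

theorem word_block {p : (morphismDiagram τ hτ).PathSpace} (hp : pos p 0 = 0) :
    word p (τ 0 (label p 1)).length = τ 0 (label p 1) := by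
  refine List.ext_getElem (by simp) fun j h1 h2 => ?_
  obtain ⟨h3, h4⟩ := iterate_within p j (by omega)
  have h5 := getElem?_pos ((vershik hτ)^[j] p) 0
  rw [h3, hp, zero_add, zero_add, label_one_eq_of_tail h4, List.getElem?_eq_getElem h2] at h5
  simp only [word, List.getElem_map, List.getElem_range]
  exact (Option.some.inj h5).symm

/-- From the bottom of a block, each step of the tail corresponds to traversing one full block `τ 0
(label p 1)`. Thus the word of a path is the image under `τ 0` of the word of its tail. -/
theorem word_flatMap {p : (morphismDiagram τ hτ).PathSpace} (hp : pos p 0 = 0) (l : ℕ) :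
    word p ((word (tail p) l).flatMap (τ 0)).length = (word (tail p) l).flatMap (τ 0) ∧
      pos ((vershik hτ)^[((word (tail p) l).flatMap (τ 0)).length] p) 0 = 0 ∧
      tail ((vershik hτ)^[((word (tail p) l).flatMap (τ 0)).length] p) =
        (vershik (tail_proper hτ))^[l] (tail p) := by
  induction l with
  | zero => simp [word, hp]
  | succ l ih =>
    obtain ⟨h1, h2, h3⟩ := ih
    set N := ((word (tail p) l).flatMap (τ 0)).length
    have h4 : word (tail p) (l + 1) =
        word (tail p) l ++ [label ((vershik hτ)^[N] p) 1] := by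
      rw [word_add, word_one, ← h3, label_tail]
    have h5 : (word (tail p) (l + 1)).flatMap (τ 0) =
        (word (tail p) l).flatMap (τ 0) ++ τ 0 (label ((vershik hτ)^[N] p) 1) := by
      rw [h4, List.flatMap_append, List.flatMap_singleton]
    have h6 := iterate_block h2
    rw [h5, List.length_append, add_comm, Function.iterate_add_apply, add_comm, word_add]
    refine ⟨?_, h6.1, ?_⟩
    · rw [h1, word_block h2]
    · rw [h6.2, h3, Function.iterate_succ_apply']

theorem word_prefix (p : (morphismDiagram τ hτ).PathSpace) {k l : ℕ} (h : k ≤ l) :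
    word p k <+: word p l := by
  obtain ⟨m, rfl⟩ := Nat.exists_eq_add_of_le h
  rw [word_add]
  exact List.prefix_append _ _

/-- Every path lies in the forward orbit of the bottom of a tower of each level. -/
theorem exists_tower (n : ℕ) {τ : ℕ → Fin 2 → List (Fin 2)} {hτ : IsProperSequence τ}
    (p : (morphismDiagram τ hτ).PathSpace) (l : ℕ) :
    ∃ (q : (morphismDiagram τ hτ).PathSpace) (h : ℕ) (c : Fin 2) (w : List (Fin 2)),
      (vershik hτ)^[h] q = p ∧ w.length = l ∧ h < (iterateMorphism τ n c).length ∧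
      word q (((c :: w).flatMap (iterateMorphism τ n)).length) =
        (c :: w).flatMap (iterateMorphism τ n) := by
  induction n generalizing τ with
  | zero =>
    refine ⟨p, 0, label p 0, word (vershik hτ p) l, rfl, by simp, by simp [iterateMorphism], ?_⟩
    have : ∀ w : List (Fin 2), w.flatMap (iterateMorphism τ 0) = w := fun w => by
      simp [iterateMorphism]
    rw [this, List.length_cons, length_word, add_comm, word_add, word_one]
    rfl
  | succ n ih =>
    obtain ⟨Q, h, c, w, h1, h2, h3, h4⟩ := ih (tail p)
    obtain ⟨q, hq, hq0⟩ := exists_tail_eq hτ Q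
    have hit : ∀ w : List (Fin 2), w.flatMap (iterateMorphism τ (n + 1)) =
        (w.flatMap (iterateMorphism (fun n => τ (n + 1)) n)).flatMap (τ 0) := by
      intro w
      rw [List.flatMap_assoc]
      rfl
    set H := ((word (tail q) h).flatMap (τ 0)).length with hH
    obtain ⟨-, h5, h6⟩ := word_flatMap hq0 h
    rw [← hH] at h5 h6
    rw [hq, h1] at h6
    have h7 := label_one_eq_of_tail h6
    have h8 := pos_lt p 0
    rw [zero_add] at h8
    obtain ⟨h9, h10⟩ := iterate_within ((vershik hτ)^[H] q) (pos p 0) (by rw [h5, h7]; omega)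
    refine ⟨q, pos p 0 + H, c, w, ?_, h2, ?_, ?_⟩
    · rw [Function.iterate_add_apply]
      exact tail_ext (h10.trans h6) (by omega)
    -- Since the tail sits at height `h` inside the block of `c`, its label belongs to that block;
    -- applying `τ 0` to the prefix ending with it bounds the new height.
    · have hpre : word Q (h + 1) <+: iterateMorphism (fun n => τ (n + 1)) n c := by
        have h11 : word Q (h + 1) <+: (c :: w).flatMap (iterateMorphism (fun n => τ (n + 1)) n) := by
          rw [← h4]
          refine word_prefix Q ?_
          rw [List.flatMap_cons, List.length_append]
          omega
        rw [List.flatMap_cons] at h11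
        exact List.prefix_of_prefix_length_le h11 (List.prefix_append _ _) (by simpa using h3)
      obtain ⟨t, ht⟩ := hpre
      have hlen : (iterateMorphism τ (n + 1) c).length =
          H + (τ 0 (label p 1)).length + (t.flatMap (τ 0)).length := by
        rw [iterateMorphism, ← ht, List.flatMap_append, word_add, List.flatMap_append, word_one,
          List.flatMap_singleton, List.length_append, List.length_append, h1, label_tail, hH, hq]
      omega
    · have h12 := (word_flatMap hq0 ((c :: w).flatMap (iterateMorphism (fun n => τ (n + 1)) n)).length).1
      rw [hq, h4] at h12
      rw [hit]
      exact h12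

end morphismDiagram

/-- The combinatorial property of `0 ↦ 011`, `1 ↦ 0²1 0³1 ⋯ 0^a 1` that makes the morphisms
recognizable: after an inner `1` in the image of `1` there are at least three zeros. -/
def IsRecognizableSequence (τ : ℕ → Fin 2 → List (Fin 2)) : Prop :=
  ∀ n, τ n 0 = [0, 1, 1] ∧ (∃ l, τ n 1 = 0 :: 0 :: 1 :: l) ∧
    ∀ pre post, τ n 1 = pre ++ 1 :: post → post = [] ∨ ∃ rest, post = 0 :: 0 :: 0 :: rest

/-! ### Recognizability: injectivity of the coding -/

namespace morphismDiagram

open OrderedBratteliDiagram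

variable {τ : ℕ → Fin 2 → List (Fin 2)} {hτ : IsProperSequence τ}

/-- The two-sided sequence of labels along the orbit of a path. -/
noncomputable def code (p : (morphismDiagram τ hτ).PathSpace) (t : ℤ) : Fin 2 :=
  label ((vershik hτ ^ t) p) 0

theorem code_zpow (p : (morphismDiagram τ hτ).PathSpace) (s t : ℤ) :
    code ((vershik hτ ^ s) p) t = code p (s + t) := by
  rw [code, code, add_comm, zpow_add]
  rfl

theorem zpow_natCast_apply (p : (morphismDiagram τ hτ).PathSpace) (j : ℕ) :
    (vershik hτ ^ (j : ℤ)) p = (vershik hτ)^[j] p := by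
  induction j with
  | zero => simp
  | succ j ih =>
    rw [Function.iterate_succ_apply', ← ih, Nat.cast_succ, add_comm, zpow_add, zpow_one]
    rfl

theorem vershik_symm_apply (p : (morphismDiagram τ hτ).PathSpace) :
    vershik hτ ((vershik hτ ^ (-1 : ℤ)) p) = p := by
  rw [zpow_neg, zpow_one]
  exact (vershik hτ).apply_symm_apply p

theorem code_natCast (p : (morphismDiagram τ hτ).PathSpace) (j : ℕ) :
    code p j = label ((vershik hτ)^[j] p) 0 := by
  rw [code, zpow_natCast_apply]

theorem code_zero (p : (morphismDiagram τ hτ).PathSpace) : code p 0 = label p 0 := by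
  simp [code]

theorem word_eq_factorAt (p : (morphismDiagram τ hτ).PathSpace) (l : ℕ) :
    word p l = factorAt (code p) 0 l := by
  refine List.ext_getElem (by simp [factorAt]) fun j h1 h2 => ?_
  simp [word, factorAt, code_natCast]

theorem continuous_label_zero :
    Continuous fun p : (morphismDiagram τ hτ).PathSpace => label p 0 := by
  rw [continuous_def]
  intro U _
  rw [isOpen_iff_mem_nhds]
  intro p hp
  refine mem_of_superset ((isOpen_agree p 1).mem_nhds fun _ _ => rfl) fun q hq => ?_
  have h : label q 0 = label p 0 := congrArg TowerFloor.tower (hq 0 Nat.one_pos)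
  rw [Set.mem_preimage, h]
  exact hp

theorem continuous_code : Continuous (code : (morphismDiagram τ hτ).PathSpace → ℤ → Fin 2) :=
  continuous_pi fun t => continuous_label_zero.comp (vershik hτ ^ t).continuous

theorem code_within (p : (morphismDiagram τ hτ).PathSpace) (j : ℕ)
    (hj : pos p 0 + j < (τ 0 (label p 1)).length) :
    (τ 0 (label p 1))[pos p 0 + j]? = some (code p j) := by
  obtain ⟨h1, h2⟩ := iterate_within p j hj
  have h3 := getElem?_pos ((vershik hτ)^[j] p) 0
  rw [h1, zero_add, label_one_eq_of_tail h2] at h3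
  rw [h3, code_natCast]

/-- The predecessor of a path is in the same tower or at the top of a tower. -/
theorem pos_pred (p : (morphismDiagram τ hτ).PathSpace) :
    (pos p 0 = 0 ∧ pos ((vershik hτ ^ (-1 : ℤ)) p) 0 + 1 =
        (τ 0 (label ((vershik hτ ^ (-1 : ℤ)) p) 1)).length) ∨
      (pos p 0 = pos ((vershik hτ ^ (-1 : ℤ)) p) 0 + 1 ∧
        tail ((vershik hτ ^ (-1 : ℤ)) p) = tail p) := by
  set q := (vershik hτ ^ (-1 : ℤ)) p with hq
  have hqp : vershik hτ q = p := vershik_symm_apply p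
  have h0 := pos_lt q 0
  rw [zero_add] at h0
  rcases (Nat.succ_le_of_lt h0).lt_or_eq with h | h
  · have := IsVershikSucc.within (isVershikSucc_vershik q) h
    rw [hqp] at this
    exact Or.inr ⟨this.1, this.2.symm⟩
  · have := IsVershikSucc.carry (isVershikSucc_vershik q) h
    rw [hqp] at this
    exact Or.inl ⟨this.1, h⟩

/-- The bottoms of the towers are recognized from the sequence of labels. -/
theorem pos_eq_zero_iff (hr : IsRecognizableSequence τ) (p : (morphismDiagram τ hτ).PathSpace) :
    pos p 0 = 0 ↔ code p (-1) = 1 ∧ code p 0 = 0 ∧ code p 2 = 1 := by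
  obtain ⟨hr0, ⟨l, hr1⟩, hr2⟩ := hr 0
  rcases pos_pred p with ⟨h1, h2⟩ | ⟨h1, h2⟩
  · refine iff_of_true h1 ⟨label_of_pos_eq_last _ h2, ?_, ?_⟩
    · rw [code_zero]
      exact label_of_pos_eq_zero p h1
    · have h3 : pos p 0 + 2 < (τ 0 (label p 1)).length ∧ (τ 0 (label p 1))[2]? = some 1 := by
        rw [h1]
        rcases Fin.exists_fin_two.1 ⟨label p 1, rfl⟩ with h | h
        · rw [h, hr0]
          simp
        · rw [h, hr1]
          simp
      have h4 := code_within p 2 h3.1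
      rw [h1, zero_add, h3.2] at h4
      exact (Option.some.inj h4).symm
  -- Inside a block the pattern `10*1` is impossible: `011` contains no `10`, and in the image of
  -- `1` an inner `1` is followed by `000`.
  · refine iff_of_false (by omega) ?_
    rintro ⟨h3, h4, h5⟩
    have h6 := getElem?_pos ((vershik hτ ^ (-1 : ℤ)) p) 0
    change _ = some (code p (-1)) at h6
    rw [h3, zero_add, label_one_eq_of_tail h2] at h6
    have h7 := getElem?_pos p 0
    rw [← code_zero, h4, h1, zero_add] at h7
    set k := pos ((vershik hτ ^ (-1 : ℤ)) p) 0
    rcases Fin.exists_fin_two.1 ⟨label p 1, rfl⟩ with h | h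
    · rw [h, hr0] at h6 h7
      obtain _ | _ | k := k
      · simp at h6
      · simp at h7
      · simp at h7
    · obtain ⟨hk, hk'⟩ := List.getElem?_eq_some_iff.1 h6
      rw [h] at h7
      simp only [h] at hk hk'
      have hsplit : τ 0 1 = (τ 0 1).take k ++ 1 :: (τ 0 1).drop (k + 1) := by
        conv_lhs => rw [← List.take_append_drop k (τ 0 1), List.drop_eq_getElem_cons hk, hk']
      rcases hr2 _ _ hsplit with h8 | ⟨rest, h8⟩
      · have := List.drop_eq_nil_iff.1 h8
        rw [List.getElem?_eq_none this] at h7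
        simp at h7
      · have h9 : (τ 0 1)[pos p 0 + 2]? = some 0 := by
          have : ((τ 0 1).drop (k + 1))[2]? = some 0 := by simp [h8]
          rwa [List.getElem?_drop, ← h1] at this
        have h10 := (List.getElem?_eq_some_iff.1 h9).1
        have h11 := code_within p 2 (by rw [h]; exact h10)
        rw [h, h9] at h11
        have h12 : code p 2 = 0 := (Option.some.inj h11).symm
        rw [h5] at h12
        exact absurd h12 (by decide)

/-- The two images begin with `01` and `00`, so the second letter of a block tells which one it is.
-/
theorem code_one_of_pos_eq_zero (hr : IsRecognizableSequence τ)
    {p : (morphismDiagram τ hτ).PathSpace} (hp : pos p 0 = 0) :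
    code p 1 = 1 - label p 1 := by
  obtain ⟨hr0, ⟨l, hr1⟩, -⟩ := hr 0
  have h3 : 1 < (τ 0 (label p 1)).length ∧ (τ 0 (label p 1))[1]? = some (1 - label p 1) := by
    rcases Fin.exists_fin_two.1 ⟨label p 1, rfl⟩ with h | h
    · rw [h, hr0]
      simp
    · rw [h, hr1]
      simp
  have h4 := code_within p 1 (by rw [hp]; simpa using h3.1)
  rw [hp, zero_add, h3.2] at h4
  exact (Option.some.inj h4).symm

theorem code_eq_zpow {p q : (morphismDiagram τ hτ).PathSpace} (h : code p = code q) (t : ℤ) :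
    code ((vershik hτ ^ t) p) = code ((vershik hτ ^ t) q) := by
  funext s
  rw [code_zpow, code_zpow, h]

/-- Walk backwards one step at a time until the bottom of the block, which the code recognizes
simultaneously for both paths. -/
theorem pos_and_label_eq (hr : IsRecognizableSequence τ)
    {p q : (morphismDiagram τ hτ).PathSpace} (h : code p = code q) :
    pos p 0 = pos q 0 ∧ label p 1 = label q 1 := by
  obtain ⟨n, hn⟩ : ∃ n, pos p 0 = n := ⟨_, rfl⟩
  induction n generalizing p q with
  | zero =>
    have hq : pos q 0 = 0 := by
      rw [pos_eq_zero_iff hr, ← h]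
      exact (pos_eq_zero_iff hr p).1 hn
    refine ⟨hn.trans hq.symm, ?_⟩
    have h1 := code_one_of_pos_eq_zero hr hn
    rw [h, code_one_of_pos_eq_zero hr hq] at h1
    exact (sub_right_injective h1).symm
  | succ n ih =>
    have hq : pos q 0 ≠ 0 := by
      rw [ne_eq, pos_eq_zero_iff hr, ← h, ← pos_eq_zero_iff hr p]
      omega
    rcases pos_pred p with ⟨h1, -⟩ | ⟨h1, h2⟩
    · omega
    rcases pos_pred q with ⟨h3, -⟩ | ⟨h3, h4⟩
    · omega
    obtain ⟨h5, h6⟩ := ih (code_eq_zpow h (-1)) (by omega)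
    rw [label_one_eq_of_tail h2, label_one_eq_of_tail h4] at h6
    exact ⟨by omega, h6⟩

/-- The bottom of the tower of a path, in its orbit. -/
theorem exists_bottom (p : (morphismDiagram τ hτ).PathSpace) :
    pos ((vershik hτ ^ (-(pos p 0 : ℤ))) p) 0 = 0 ∧
      tail ((vershik hτ ^ (-(pos p 0 : ℤ))) p) = tail p := by
  obtain ⟨n, hn⟩ : ∃ n, pos p 0 = n := ⟨_, rfl⟩
  induction n generalizing p with
  | zero => simp [hn]
  | succ n ih =>
    rcases pos_pred p with ⟨h1, -⟩ | ⟨h1, h2⟩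
    · omega
    have h3 : pos ((vershik hτ ^ (-1 : ℤ)) p) 0 = n := by omega
    have h4 := ih _ h3
    have h5 : (vershik hτ ^ (-(pos p 0 : ℤ))) p =
        (vershik hτ ^ (-(n : ℤ))) ((vershik hτ ^ (-1 : ℤ)) p) := by
      rw [hn, Nat.cast_succ, neg_add, zpow_add]
      rfl
    rw [h5]
    rw [h3] at h4
    exact ⟨h4.1, h4.2.trans h2⟩

theorem code_tail_eq (hr : IsRecognizableSequence τ)
    {p q : (morphismDiagram τ hτ).PathSpace} (h : code p = code q) :
    code (tail p) = code (tail q) := by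
  -- `R` relates the tails of two block bottoms with equal codes. Equal codes give equal block
  -- lengths, so moving to the next or previous block uses the same power of the Vershik map on both
  -- sides; `R` is thus invariant and forces equal labels at all times.
  let R : (P Q : (morphismDiagram (fun n => τ (n + 1)) (tail_proper hτ)).PathSpace) → Prop :=
    fun P Q => ∃ p q : (morphismDiagram τ hτ).PathSpace,
      code p = code q ∧ pos p 0 = 0 ∧ pos q 0 = 0 ∧ tail p = P ∧ tail q = Q
  have hlabel : ∀ {P Q}, R P Q → label P 0 = label Q 0 := by
    rintro P Q ⟨p, q, hpq, -, -, rfl, rfl⟩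
    rw [label_tail, label_tail]
    exact (pos_and_label_eq hr hpq).2
  have hsucc : ∀ {P Q}, R P Q → R (vershik _ P) (vershik _ Q) := by
    rintro P Q ⟨p, q, hpq, hp, hq, rfl, rfl⟩
    obtain ⟨h1, h2⟩ := iterate_block hp
    obtain ⟨h3, h4⟩ := iterate_block hq
    refine ⟨_, _, ?_, h1, h3, h2, h4⟩
    rw [← zpow_natCast_apply, ← zpow_natCast_apply, (pos_and_label_eq hr hpq).2]
    exact code_eq_zpow hpq _
  have hpred : ∀ {P Q}, R P Q →
      R ((vershik (tail_proper hτ) ^ (-1 : ℤ)) P) ((vershik (tail_proper hτ) ^ (-1 : ℤ)) Q) := by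
    rintro P Q ⟨p, q, hpq, hp, hq, rfl, rfl⟩
    have key : ∀ {p : (morphismDiagram τ hτ).PathSpace}, pos p 0 = 0 →
        tail ((vershik hτ ^ (-1 : ℤ)) p) = (vershik (tail_proper hτ) ^ (-1 : ℤ)) (tail p) := by
      intro p hp
      rcases pos_pred p with ⟨-, h2⟩ | ⟨h1, -⟩
      · have h3 := (tail_vershik h2).2
        rw [vershik_symm_apply] at h3
        apply (vershik (tail_proper hτ)).injective
        rw [vershik_symm_apply, h3]
      · omega
    have h1 := code_eq_zpow hpq (-1)
    have h2 := exists_bottom ((vershik hτ ^ (-1 : ℤ)) p)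
    have h3 := exists_bottom ((vershik hτ ^ (-1 : ℤ)) q)
    refine ⟨_, _, ?_, h2.1, h3.1, h2.2.trans (key hp), h3.2.trans (key hq)⟩
    rw [(pos_and_label_eq hr h1).1]
    exact code_eq_zpow h1 _
  have hall : ∀ (t : ℤ) {P Q}, R P Q →
      R ((vershik (tail_proper hτ) ^ t) P) ((vershik (tail_proper hτ) ^ t) Q) := by
    intro t P Q hPQ
    induction t with
    | zero => simpa using hPQ
    | succ t ih =>
      rw [add_comm, zpow_add, zpow_one]
      exact hsucc ih
    | pred t ih =>
      rw [sub_eq_add_neg, add_comm, zpow_add]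
      exact hpred ih
  funext t
  refine hlabel (hall t ⟨_, _, code_eq_zpow h (-(pos p 0 : ℤ)), (exists_bottom p).1, ?_,
    (exists_bottom p).2, ?_⟩)
  · rw [(pos_and_label_eq hr h).1]
    exact (exists_bottom q).1
  · rw [(pos_and_label_eq hr h).1]
    exact (exists_bottom q).2

/-- Desubstitute repeatedly: level `n + 1` of a path is level `n` of its tail, and equality of codes
passes to tails. -/
theorem pos_and_label_eq_all (n : ℕ) {τ : ℕ → Fin 2 → List (Fin 2)} {hτ : IsProperSequence τ}
    (hr : IsRecognizableSequence τ) {p q : (morphismDiagram τ hτ).PathSpace}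
    (h : code p = code q) : pos p n = pos q n ∧ label p n = label q n := by
  induction n generalizing τ with
  | zero =>
    refine ⟨(pos_and_label_eq hr h).1, ?_⟩
    rw [← code_zero, ← code_zero, h]
  | succ n ih =>
    have := ih (fun n => hr (n + 1)) (code_tail_eq hr h)
    simpa using this

theorem code_injective (hr : IsRecognizableSequence τ) :
    Function.Injective (code : (morphismDiagram τ hτ).PathSpace → ℤ → Fin 2) := fun _ _ h =>
  path_ext (fun n => (pos_and_label_eq_all n hr h).2) fun n => (pos_and_label_eq_all n hr h).1

end morphismDiagram

/-! ### The words of the example -/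

theorem blocks_eq_nil_or (s k : ℕ) (hs : 3 ≤ s) :
    ((List.range' s k).flatMap fun j => List.replicate j (0 : Fin 2) ++ [1]) = [] ∨
      ∃ rest, ((List.range' s k).flatMap fun j => List.replicate j (0 : Fin 2) ++ [1]) =
        0 :: 0 :: 0 :: rest := by
  cases k with
  | zero => exact Or.inl rfl
  | succ k =>
    obtain ⟨m, rfl⟩ := Nat.exists_eq_add_of_le' hs
    rw [List.range'_succ, List.flatMap_cons]
    exact Or.inr ⟨_, rfl⟩

/-- In `0^s 1 0^(s+1) 1 ⋯ 0^(s+k-1) 1` every inner `1` is followed by three zeros. -/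
theorem blocks_split (s k : ℕ) (hs : 2 ≤ s) (pre post : List (Fin 2))
    (h : ((List.range' s k).flatMap fun j => List.replicate j (0 : Fin 2) ++ [1]) =
      pre ++ 1 :: post) : post = [] ∨ ∃ rest, post = 0 :: 0 :: 0 :: rest := by
  induction k generalizing s pre with
  | zero => simp at h
  | succ k ih =>
    rw [List.range'_succ, List.flatMap_cons, List.append_assoc, List.append_eq_append_iff] at h
    rcases h with ⟨as, h1, h2⟩ | ⟨bs, h1, h2⟩
    · cases as with
      | nil =>
        simp only [List.cons_append, List.nil_append, List.cons.injEq, true_and] at h2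
        rw [← h2]
        exact blocks_eq_nil_or (s + 1) k (by omega)
      | cons c as =>
        simp only [List.cons_append, List.nil_append, List.cons.injEq] at h2
        exact ih (s + 1) (by omega) as h2.2
    · cases bs with
      | nil =>
        simp only [List.nil_append, List.cons_append, List.cons.injEq, true_and] at h2
        rw [h2]
        exact blocks_eq_nil_or (s + 1) k (by omega)
      | cons c bs =>
        simp only [List.cons_append, List.cons.injEq] at h2
        have : (1 : Fin 2) ∈ List.replicate s 0 := by rw [h1, h2.1]; simp
        exact absurd (List.eq_of_mem_replicate this) (by decide)

theorem exampleMorphism_zero (a : ℕ → ℕ) (n : ℕ) : exampleMorphism a n 0 = [0, 1, 1] := rfl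

theorem exampleMorphism_one (a : ℕ → ℕ) (n : ℕ) : exampleMorphism a n 1 =
    (List.range' 2 (a n - 1)).flatMap fun j => List.replicate j 0 ++ [1] := rfl

variable {a : ℕ → ℕ}

theorem isProperSequence_exampleMorphism (ha : ∀ n, 2 ≤ a n) :
    IsProperSequence (exampleMorphism a) := by
  intro n b
  rcases Fin.exists_fin_two.1 ⟨b, rfl⟩ with rfl | rfl
  · exact ⟨[1], rfl⟩
  · obtain ⟨k, hk⟩ := Nat.exists_eq_add_of_le (ha n)
    rw [exampleMorphism_one, hk, show 2 + k - 1 = k + 1 by omega]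
    rcases Nat.eq_zero_or_pos k with rfl | hk0
    · exact ⟨[0], rfl⟩
    · obtain ⟨j, rfl⟩ := Nat.exists_eq_succ_of_ne_zero hk0.ne'
      rw [List.range'_succ, List.flatMap_cons, List.range'_concat, List.flatMap_append,
        List.flatMap_singleton]
      refine ⟨[0, 1] ++ ((List.range' (2 + 1) j).flatMap (fun j => List.replicate j 0 ++ [1]) ++
        List.replicate (2 + 1 + 1 * j) 0), ?_⟩
      simp [List.replicate_succ]

theorem isRecognizableSequence_exampleMorphism (ha : ∀ n, 2 ≤ a n) :
    IsRecognizableSequence (exampleMorphism a) := by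
  intro n
  refine ⟨rfl, ?_, fun pre post h => blocks_split 2 _ le_rfl pre post h⟩
  obtain ⟨k, hk⟩ := Nat.exists_eq_add_of_le (ha n)
  rw [exampleMorphism_one, hk, show 2 + k - 1 = k + 1 by omega, List.range'_succ,
    List.flatMap_cons]
  exact ⟨_, rfl⟩

/-- The word `τ_{[0, n)}(b)`. -/
abbrev levelWord (a : ℕ → ℕ) (n : ℕ) (b : Fin 2) : List (Fin 2) :=
  iterateMorphism (exampleMorphism a) n b

theorem levelWord_succ (a : ℕ → ℕ) (n : ℕ) (b : Fin 2) :
    levelWord a (n + 1) b = (exampleMorphism a n b).flatMap (levelWord a n) :=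
  iterateMorphism_succ' _ _ _

theorem levelWord_succ_zero (a : ℕ → ℕ) (n : ℕ) :
    levelWord a (n + 1) 0 = levelWord a n 0 ++ (levelWord a n 1 ++ levelWord a n 1) := by
  rw [levelWord_succ, exampleMorphism_zero]
  simp

theorem levelWord_infix_succ (ha : ∀ n, 2 ≤ a n) (n : ℕ) (b c : Fin 2) :
    levelWord a n b <:+: levelWord a (n + 1) c := by
  rw [levelWord_succ]
  refine List.infix_flatMap_of_mem ?_ _
  obtain ⟨l, hl⟩ := isProperSequence_exampleMorphism ha n c
  rw [hl]
  rcases Fin.exists_fin_two.1 ⟨b, rfl⟩ with rfl | rfl <;> simp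

theorem levelWord_infix_of_lt (ha : ∀ n, 2 ≤ a n) {n m : ℕ} (h : n < m) (b c : Fin 2) :
    levelWord a n b <:+: levelWord a m c := by
  induction m generalizing c with
  | zero => omega
  | succ m ih =>
    rcases Nat.lt_succ_iff_lt_or_eq.1 h with h | rfl
    · exact (ih h 0).trans (levelWord_infix_succ ha m 0 c)
    · exact levelWord_infix_succ ha n b c

/-- The language of the example. -/
def exampleLanguage (a : ℕ → ℕ) : Set (List (Fin 2)) := {w | ∃ n, w <:+: levelWord a n 0}

theorem mem_exampleLanguage_of_infix {v w : List (Fin 2)} (hw : w ∈ exampleLanguage a)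
    (h : v <:+: w) : v ∈ exampleLanguage a := by
  obtain ⟨n, hn⟩ := hw
  exact ⟨n, h.trans hn⟩

theorem mem_exampleLanguage_of_levelWord (ha : ∀ n, 2 ≤ a n) {n : ℕ} {b : Fin 2}
    {w : List (Fin 2)} (hw : w <:+: levelWord a n b) : w ∈ exampleLanguage a :=
  ⟨n + 1, hw.trans (levelWord_infix_succ ha n b 0)⟩

/-- The letter `0` alone suffices, since every level word occurs in both level words one level up.
-/
theorem sadicLanguage_eq (ha : ∀ n, 2 ≤ a n) :
    sadicLanguage (A := fun _ => Fin 2) (exampleMorphism a) 0 = exampleLanguage a := by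
  ext w
  constructor
  · rintro ⟨k, -, b, hw⟩
    rw [← iterateMorphism_eq_composedMorphism] at hw
    exact mem_exampleLanguage_of_levelWord ha hw
  · rintro ⟨n, hn⟩
    refine ⟨n + 1, n.succ_pos, (0 : Fin 2), ?_⟩
    rw [← iterateMorphism_eq_composedMorphism]
    exact hn.trans (levelWord_infix_succ ha n 0 0)

theorem mem_exampleSubshift_iff (ha : ∀ n, 2 ≤ a n) {x : ℤ → Fin 2} :
    x ∈ (exampleSubshift a).carrier ↔ ∀ m l, factorAt x m l ∈ exampleLanguage a := by
  rw [← sadicLanguage_eq ha]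
  exact Iff.rfl

theorem exists_levelWord_eq_flatMap {n m : ℕ} (h : n ≤ m) (c : Fin 2) :
    ∃ y : List (Fin 2), levelWord a m c = y.flatMap (levelWord a n) := by
  induction m generalizing c with
  | zero =>
    obtain rfl := Nat.le_zero.1 h
    exact ⟨[c], by simp⟩
  | succ m ih =>
    rcases Nat.le_succ_iff.1 h with h | rfl
    · choose y hy using ih h
      refine ⟨(exampleMorphism a m c).flatMap y, ?_⟩
      rw [levelWord_succ, List.flatMap_assoc]
      exact List.flatMap_congr fun b _ => hy b
    · exact ⟨[c], by simp⟩

theorem mem_exampleLanguage_iff_flatMap (ha : ∀ n, 2 ≤ a n) (n : ℕ) {w : List (Fin 2)}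
    (hw : w ∈ exampleLanguage a) :
    ∃ y : List (Fin 2), w <:+: y.flatMap (levelWord a n) := by
  obtain ⟨m, hm⟩ := hw
  obtain ⟨y, hy⟩ := exists_levelWord_eq_flatMap (a := a) (le_max_left n (m + 1)) 0
  refine ⟨y, hy ▸ hm.trans (levelWord_infix_of_lt ha ?_ 0 0)⟩
  exact lt_of_lt_of_le m.lt_succ_self (le_max_right _ _)

theorem List.exists_prefix_of_prefix_flatMap {α β : Type*} {f : α → List β} {L : ℕ}
    (hf : ∀ x, (f x).length ≤ L) {y : List α} {z : List β} (hz : z <+: y.flatMap f)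
    (hne : z ≠ []) (hL : L ≤ z.length) : ∃ x, f x <+: z := by
  cases y with
  | nil => exact absurd (List.prefix_nil.1 hz) hne
  | cons x y =>
    rw [List.flatMap_cons] at hz
    exact ⟨x, List.prefix_of_prefix_length_le (List.prefix_append _ _) hz ((hf x).trans hL)⟩

/-- A long factor of a concatenation contains one of the concatenated words. -/
theorem List.exists_infix_of_infix_flatMap {α β : Type*} {f : α → List β} {L : ℕ}
    (hf : ∀ x, (f x).length ≤ L) {y : List α} {z : List β} (hz : z <:+: y.flatMap f)
    (hL : 2 * L < z.length) : ∃ x, f x <:+: z := by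
  induction y with
  | nil =>
    have := hz.length_le
    rw [List.flatMap_nil, List.length_nil] at this
    omega
  | cons x y ih =>
    rw [List.flatMap_cons, List.infix_append_iff] at hz
    rcases hz with h | h | ⟨s, p, rfl, hs, hp⟩
    · have := h.length_le
      have := hf x
      omega
    · exact ih h
    · have h1 := hs.length_le
      have h2 := hf x
      rw [List.length_append] at hL
      obtain ⟨x, hx⟩ := List.exists_prefix_of_prefix_flatMap hf hp
        (by rintro rfl; simp at hL; omega) (by omega)
      exact ⟨x, hx.isInfix.trans (List.suffix_append _ _).isInfix⟩

theorem length_factorAt {A : Type*} (x : ℤ → A) (m : ℤ) (l : ℕ) : (factorAt x m l).length = l := by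
  simp [factorAt]

theorem factorAt_add {A : Type*} (x : ℤ → A) (m : ℤ) (k l : ℕ) :
    factorAt x m (k + l) = factorAt x m k ++ factorAt x (m + k) l := by
  simp only [factorAt, List.ofFn_add]
  congr 2
  funext i
  simp [add_assoc]

theorem exists_factorAt_eq_of_infix {A : Type*} {x : ℤ → A} {m : ℤ} {l : ℕ} {w : List A}
    (h : w <:+: factorAt x m l) : ∃ k : ℤ, factorAt x k w.length = w := by
  obtain ⟨s, t, h⟩ := h
  have hl : l = s.length + w.length + t.length := by
    rw [← length_factorAt x m l, ← h]
    simp [add_assoc]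
  rw [hl, factorAt_add, factorAt_add] at h
  have h1 := (List.append_inj h (by simp [length_factorAt])).1
  have h2 := (List.append_inj h1 (by simp [length_factorAt])).2
  exact ⟨_, h2.symm⟩

/-- Every word of the language occurs in every point. -/
theorem exists_factorAt_eq (ha : ∀ n, 2 ≤ a n) {x : ℤ → Fin 2}
    (hx : x ∈ (exampleSubshift a).carrier) {w : List (Fin 2)} (hw : w ∈ exampleLanguage a) :
    ∃ m, factorAt x m w.length = w := by
  obtain ⟨n, hn⟩ := hw
  set L := max (levelWord a (n + 1) 0).length (levelWord a (n + 1) 1).length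
  have hL : ∀ b, (levelWord a (n + 1) b).length ≤ L := by
    intro b
    rcases Fin.exists_fin_two.1 ⟨b, rfl⟩ with rfl | rfl
    · exact le_max_left _ _
    · exact le_max_right _ _
  -- A window longer than two blocks contains a complete block of level `n + 1`, whichever letter it
  -- comes from, and this contains `levelWord a n 0`.
  have h1 := (mem_exampleSubshift_iff ha).1 hx 0 (2 * L + 1)
  obtain ⟨y, hy⟩ := mem_exampleLanguage_iff_flatMap ha (n + 1) h1
  obtain ⟨b, hb⟩ := List.exists_infix_of_infix_flatMap hL hy (by rw [length_factorAt]; omega)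
  exact exists_factorAt_eq_of_infix ((hn.trans (levelWord_infix_succ ha n 0 b)).trans hb)

theorem shift_zpow_apply {A : Type*} [TopologicalSpace A] (X : Subshift A) (x : X.carrier)
    (t i : ℤ) : ((X.shift ^ t) x).1 i = x.1 (i + t) := by
  induction t generalizing i with
  | zero => simp
  | succ t ih =>
    rw [add_comm (t : ℤ), zpow_add, zpow_one, Homeomorph.mul_apply]
    change ((X.shift ^ (t : ℤ)) x).1 (i + 1) = _
    rw [ih]
    exact congrArg x.1 (by ring)
  | pred t ih =>
    rw [sub_eq_add_neg, add_comm (-(t : ℤ)), zpow_add, zpow_neg_one, Homeomorph.mul_apply]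
    change ((X.shift ^ (-(t : ℤ))) x).1 (i - 1) = _
    rw [ih]
    exact congrArg x.1 (by ring)

/-- Points of a subshift sharing a long enough central word with a point of an open set are in that
open set. -/
theorem exists_central_word {A : Type*} [TopologicalSpace A] {C : Set (ℤ → A)} {U : Set C}
    (hU : IsOpen U) {y : C} (hy : y ∈ U) :
    ∃ l : ℕ, ∀ z : C, factorAt z.1 (-l) (2 * l + 1) = factorAt y.1 (-l) (2 * l + 1) → z ∈ U := by
  obtain ⟨W, hW, rfl⟩ := isOpen_induced_iff.1 hU
  obtain ⟨I, u, hI, hIW⟩ := isOpen_pi_iff.1 hW y.1 hy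
  refine ⟨I.sup Int.natAbs, fun z hz => hIW fun i hi => ?_⟩
  have hle : i.natAbs ≤ I.sup Int.natAbs := Finset.le_sup (f := Int.natAbs) hi
  set l := I.sup Int.natAbs
  have h1 := congrFun (List.ofFn_injective hz) ⟨(i + l).toNat, by omega⟩
  have h2 : (-(l : ℤ)) + (((i + l).toNat : ℕ) : ℤ) = i := by omega
  simp only [h2] at h1
  rw [h1]
  exact (hI i hi).2

/-- Every word of the language occurs in every point, so each orbit visits the cylinder of each
central word. -/
theorem isMinimalSystem_exampleSubshift (ha : ∀ n, 2 ≤ a n) :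
    IsMinimalSystem (exampleSubshift a).shift := by
  intro x
  rw [dense_iff_inter_open]
  rintro U hU ⟨y, hy⟩
  obtain ⟨l, hl⟩ := exists_central_word hU hy
  obtain ⟨m, hm⟩ := exists_factorAt_eq ha x.2
    ((mem_exampleSubshift_iff ha).1 y.2 (-(l : ℤ)) (2 * l + 1))
  rw [length_factorAt] at hm
  refine ⟨_, hl (((exampleSubshift a).shift ^ (m + l)) x) ?_, m + l, rfl⟩
  rw [← hm]
  simp only [factorAt]
  congr 1
  funext i
  rw [shift_zpow_apply]
  exact congrArg x.1 (by ring)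

/-! ### Bratteli-Vershik representation and topological rank -/

theorem exists_levelWord_one_succ (ha : ∀ n, 2 ≤ a n) (n : ℕ) :
    ∃ t, levelWord a (n + 1) 1 = levelWord a n 0 ++ (levelWord a n 0 ++ (levelWord a n 1 ++ t)) := by
  obtain ⟨-, ⟨l, hl⟩, -⟩ := isRecognizableSequence_exampleMorphism ha n
  rw [levelWord_succ, hl]
  exact ⟨l.flatMap (levelWord a n), by simp⟩

/-- Here `00` starts the image of `1`, while `01` and `11` lie in `011`. -/
theorem append_levelWord_mem (ha : ∀ n, 2 ≤ a n) (n : ℕ) (c d : Fin 2) :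
    levelWord a n c ++ levelWord a n d ∈ exampleLanguage a := by
  have h0 := levelWord_succ_zero a n
  obtain ⟨t, h1⟩ := exists_levelWord_one_succ ha n
  rcases Fin.exists_fin_two.1 ⟨c, rfl⟩ with rfl | rfl <;>
    rcases Fin.exists_fin_two.1 ⟨d, rfl⟩ with rfl | rfl
  · refine mem_exampleLanguage_of_levelWord ha (n := n + 1) (b := 1) ?_
    rw [h1, ← List.append_assoc]
    exact (List.prefix_append _ _).isInfix
  · refine mem_exampleLanguage_of_levelWord ha (n := n + 1) (b := 0) ?_
    rw [h0, ← List.append_assoc]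
    exact (List.prefix_append _ _).isInfix
  -- When `a n = 2` the images are `011` and `001`, neither containing `10`; it appears where the
  -- image of `0` meets that of `1`, hence the two levels.
  · refine mem_exampleLanguage_of_levelWord ha (n := n + 2) (b := 0) ?_
    rw [levelWord_succ_zero, h0, h1]
    exact ⟨levelWord a n 0 ++ levelWord a n 1, levelWord a n 0 ++ (levelWord a n 1 ++ t) ++
      (levelWord a n 0 ++ (levelWord a n 0 ++ (levelWord a n 1 ++ t))), by simp⟩
  · refine mem_exampleLanguage_of_levelWord ha (n := n + 1) (b := 0) ?_
    rw [h0]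
    exact (List.suffix_append _ _).isInfix

theorem lt_length_levelWord (ha : ∀ n, 2 ≤ a n) (n : ℕ) (b : Fin 2) :
    n < (levelWord a n b).length := by
  induction n generalizing b with
  | zero => simp [iterateMorphism]
  | succ n ih =>
    obtain ⟨l, hl⟩ := isProperSequence_exampleMorphism ha n b
    rw [levelWord_succ, hl, List.flatMap_cons, List.flatMap_append, List.flatMap_singleton]
    simp only [List.length_append]
    have := ih 0
    have := ih 1
    omega

open morphismDiagram

/-- A window of length `l` starts in a block of level `l`, and all such blocks are longer than `l`.
It therefore fits in two consecutive blocks, whose concatenation is in the language. -/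
theorem code_mem_exampleSubshift (ha : ∀ n, 2 ≤ a n)
    (p : (morphismDiagram _ (isProperSequence_exampleMorphism ha)).PathSpace) :
    code p ∈ (exampleSubshift a).carrier := by
  rw [mem_exampleSubshift_iff ha]
  intro m l
  have h0 : factorAt (code p) m l = word ((vershik _ ^ m) p) l := by
    rw [word_eq_factorAt]
    simp only [factorAt, code_zpow, zero_add]
  rw [h0]
  obtain ⟨q, h, c, w, h1, h2, h3, h4⟩ := exists_tower l ((vershik _ ^ m) p) 1
  obtain ⟨d, rfl⟩ := List.length_eq_one_iff.1 h2
  rw [List.flatMap_cons, List.flatMap_singleton] at h4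
  refine mem_exampleLanguage_of_infix (append_levelWord_mem ha l c d) ?_
  have h5 : l < (iterateMorphism (exampleMorphism a) l d).length := lt_length_levelWord ha l d
  have h6 : word q (h + l) <+: levelWord a l c ++ levelWord a l d := by
    rw [← h4]
    refine word_prefix q ?_
    rw [List.length_append]
    omega
  rw [word_add, h1] at h6
  exact (List.suffix_append _ _).isInfix.trans h6.isInfix

theorem compactSpace_exampleSubshift (a : ℕ → ℕ) : CompactSpace (exampleSubshift a).carrier :=
  isCompact_iff_compactSpace.1 (exampleSubshift a).isClosed.isCompact

/-- The coding map from the path space to the subshift. -/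
noncomputable def codePoint (ha : ∀ n, 2 ≤ a n)
    (p : (morphismDiagram _ (isProperSequence_exampleMorphism ha)).PathSpace) :
    (exampleSubshift a).carrier := ⟨code p, code_mem_exampleSubshift ha p⟩

theorem continuous_codePoint (ha : ∀ n, 2 ≤ a n) : Continuous (codePoint ha) :=
  continuous_code.subtype_mk _

theorem codePoint_zpow (ha : ∀ n, 2 ≤ a n)
    (p : (morphismDiagram _ (isProperSequence_exampleMorphism ha)).PathSpace) (t : ℤ) :
    codePoint ha ((vershik _ ^ t) p) = ((exampleSubshift a).shift ^ t) (codePoint ha p) := by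
  apply Subtype.ext
  funext s
  rw [shift_zpow_apply]
  exact (code_zpow p t s).trans (by rw [add_comm]; rfl)

theorem nonempty_pathSpace (ha : ∀ n, 2 ≤ a n) :
    Nonempty (morphismDiagram _ (isProperSequence_exampleMorphism ha)).PathSpace :=
  ⟨(isProperlyOrdered (isProperSequence_exampleMorphism ha)).1.choose⟩

/-- Injectivity is recognizability. The range is compact and contains a full orbit, which is dense,
so it is everything. -/
theorem codePoint_bijective (ha : ∀ n, 2 ≤ a n) : Function.Bijective (codePoint ha) := by
  constructor
  · intro p q h
    exact code_injective (isRecognizableSequence_exampleMorphism ha) (congrArg Subtype.val h)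
  · obtain ⟨p⟩ := nonempty_pathSpace ha
    have h1 := isMinimalSystem_exampleSubshift ha (codePoint ha p)
    have h2 : Dense (Set.range (codePoint ha)) := by
      refine h1.mono ?_
      rintro _ ⟨n, rfl⟩
      exact ⟨_, codePoint_zpow ha p n⟩
    have h3 : IsClosed (Set.range (codePoint ha)) :=
      (isCompact_range (continuous_codePoint ha)).isClosed
    exact Set.range_eq_univ.1 (h3.closure_eq ▸ h2.closure_eq)

theorem isRepresentationOf_exampleSubshift (ha : ∀ n, 2 ≤ a n) :
    (morphismDiagram _ (isProperSequence_exampleMorphism ha)).IsRepresentationOf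
      (exampleSubshift a).shift := by
  refine ⟨isSimple _, isProperlyOrdered _,
    (Continuous.homeoOfEquivCompactToT2 (f := Equiv.ofBijective _ (codePoint_bijective ha))
      (continuous_codePoint ha)).symm, fun x => ?_⟩
  obtain ⟨p, rfl⟩ := (codePoint_bijective ha).2 x
  have h : ∀ q, (Equiv.ofBijective _ (codePoint_bijective ha)).symm (codePoint ha q) = q :=
    Equiv.ofBijective_symm_apply_apply _ _
  have h1 := codePoint_zpow ha p 1
  rw [zpow_one, zpow_one] at h1
  change (Equiv.ofBijective _ (codePoint_bijective ha)).symm _ =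
    vershik _ ((Equiv.ofBijective _ (codePoint_bijective ha)).symm _)
  rw [← h1, h, h]

/-! ### Perfectness, and complexity for one vertex per level -/

namespace Subshift

theorem wordsOfLength_eq_range {A : Type*} [TopologicalSpace A] (X : Subshift A) (l : ℕ) :
    X.wordsOfLength l = Set.range fun x : X.carrier => factorAt x.1 0 l := by
  ext w
  constructor
  · rintro ⟨x, hx, m, rfl⟩
    refine ⟨(X.shift ^ m) ⟨x, hx⟩, ?_⟩
    simp only [factorAt, shift_zpow_apply]
    congr 1
    funext i
    congr 1
    ring
  · rintro ⟨x, rfl⟩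
    exact ⟨x.1, x.2, 0, rfl⟩

theorem complexity_le_of_finite {A : Type*} [TopologicalSpace A] (X : Subshift A)
    [Finite X.carrier] (l : ℕ) : X.complexity l ≤ Nat.card X.carrier := by
  rw [complexity, wordsOfLength_eq_range, ← Set.image_univ, ← Set.ncard_univ]
  exact Set.ncard_image_le Set.finite_univ

/-- A minimal subshift of unbounded complexity has no isolated points. -/
theorem perfectSpace_of_unbounded {A : Type*} [TopologicalSpace A] (X : Subshift A)
    [CompactSpace X.carrier] (hmin : IsMinimalSystem X.shift)
    (hX : ∀ K, ∃ l, K < X.complexity l) : PerfectSpace X.carrier := by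
  rw [perfectSpace_iff_forall_not_isolated]
  intro x
  by_contra hx
  rw [not_neBot, ← isOpen_singleton_iff_punctured_nhds] at hx
  -- Every orbit meets an isolated point, so one isolated point makes all points isolated; by
  -- compactness the subshift is then finite.
  have hdisc : DiscreteTopology X.carrier := by
    rw [discreteTopology_iff_isOpen_singleton]
    intro y
    obtain ⟨z, hz, n, hn⟩ := (hmin y).inter_open_nonempty _ hx ⟨x, rfl⟩
    simp only at hn
    have : {y} = (X.shift ^ n) ⁻¹' {x} := by
      ext z'
      rw [Set.mem_preimage, Set.mem_singleton_iff, Set.mem_singleton_iff,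
        ← Set.mem_singleton_iff.1 hz, ← hn]
      exact (X.shift ^ n).injective.eq_iff.symm
    rw [this]
    exact hx.preimage (X.shift ^ n).continuous
  have := finite_of_compact_of_discrete (X := X.carrier)
  obtain ⟨l, hl⟩ := hX (Nat.card X.carrier)
  exact absurd (X.complexity_le_of_finite l) (not_le.2 hl)

end Subshift

namespace OrderedBratteliDiagram

variable {B : OrderedBratteliDiagram}

theorem exists_agree_of_continuous {f : B.PathSpace → Fin 2} (hf : Continuous f) :
    ∃ N, ∀ p q : B.PathSpace, (∀ i < N, p.1 i = q.1 i) → f p = f q := by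
  have h : ∀ p : B.PathSpace, ∃ N, {q : B.PathSpace | ∀ i < N, q.1 i = p.1 i} ⊆ f ⁻¹' {f p} :=
    fun p => exists_agree_subset ((isOpen_discrete _).preimage hf) rfl
  choose N hN using h
  obtain ⟨t, ht⟩ := isCompact_univ.elim_finite_subcover
    (fun p : B.PathSpace => {q : B.PathSpace | ∀ i < N p, q.1 i = p.1 i})
    (fun p => isOpen_agree p (N p)) fun p _ => Set.mem_iUnion.2 ⟨p, fun _ _ => rfl⟩
  refine ⟨t.sup N, fun q q' hqq => ?_⟩
  obtain ⟨p, hp, hq⟩ := Set.mem_iUnion₂.1 (ht (Set.mem_univ q))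
  have hle : N p ≤ t.sup N := Finset.le_sup hp
  have h1 : f q = f p := hN p hq
  have h2 : f q' = f p := hN p fun i hi => (hqq i (by omega)).symm.trans (hq i hi)
  rw [h1, h2]

/-- A subshift represented by a diagram with one vertex at every level has bounded complexity. -/
theorem IsRepresentationOf.complexity_le {X : Subshift (Fin 2)} (h : B.IsRepresentationOf X.shift)
    (hcard : ∀ n, Nat.card (B.V n) ≤ 1) : ∃ K, ∀ l, X.complexity l ≤ K := by
  obtain ⟨-, hB, π, hπ⟩ := h
  have hsub : ∀ n, Subsingleton (B.V n) := fun n => Finite.card_le_one_iff_subsingleton.1 (hcard n)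
  have hf : Continuous fun p : B.PathSpace => (π.symm p).1 0 :=
    (continuous_apply 0).comp (continuous_subtype_val.comp π.symm.continuous)
  obtain ⟨N, hN⟩ := exists_agree_of_continuous hf
  -- With one vertex per level, minimal edges of a level coincide, so the Vershik map preserves
  -- agreement below `N`. The first `N` edges then determine every coordinate of nonnegative index,
  -- and there are finitely many choices for them.
  have hstep : ∀ (i : ℕ) {p q : B.PathSpace}, (∀ i < N, p.1 i = q.1 i) →
      ∀ j < N, ((vershikMap hB)^[i] p).1 j = ((vershikMap hB)^[i] q).1 j := by
    intro i p q hpq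
    induction i with
    | zero => exact hpq
    | succ i ih =>
      rw [Function.iterate_succ_apply', Function.iterate_succ_apply']
      rcases (isVershikSucc_vershikMap hB _).agree_or_isMin (isVershikSucc_vershikMap hB _) ih with
        h | h
      · exact h
      · exact fun j hj => eq_of_isMin (h j hj).1 (h j hj).2 (Subsingleton.elim _ _)
  have hcoord : ∀ (i : ℕ) (x : X.carrier), x.1 i = (π.symm ((vershikMap hB)^[i] (π x))).1 0 := by
    intro i
    induction i with
    | zero => simp
    | succ i ih =>
      intro x
      rw [Function.iterate_succ_apply, ← hπ, ← ih]
      rfl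
  have key : ∀ (x y : X.carrier) (l : ℕ), (∀ i < N, (π x).1 i = (π y).1 i) →
      factorAt x.1 0 l = factorAt y.1 0 l := by
    intro x y l hxy
    simp only [factorAt, zero_add]
    congr 1
    funext i
    rw [hcoord, hcoord]
    exact hN _ _ (hstep i hxy)
  refine ⟨Nat.card (∀ i : Fin N, B.E i), fun l => ?_⟩
  rw [Subshift.complexity, Subshift.wordsOfLength_eq_range, ← Nat.card_coe_set_eq]
  refine Nat.card_le_card_of_injective (fun w : Set.range _ => fun i => (π w.2.choose).1 i) ?_
  intro w w' hww
  apply Subtype.ext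
  rw [← w.2.choose_spec, ← w'.2.choose_spec]
  exact key _ _ l fun i hi => congrFun hww ⟨i, hi⟩

end OrderedBratteliDiagram

/-- Unbounded complexity is used twice: to exclude isolated points, and to exclude a representation
with fewer than two vertices per level. -/
theorem hasTopologicalRank_exampleSubshift (ha : ∀ n, 2 ≤ a n)
    (hX : ∀ K, ∃ l, K < (exampleSubshift a).complexity l) :
    HasTopologicalRank (exampleSubshift a).shift 2 := by
  have hmin := isMinimalSystem_exampleSubshift ha
  have := compactSpace_exampleSubshift a
  refine ⟨⟨(nonempty_pathSpace ha).map (codePoint ha), this, inferInstance, inferInstance,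
    Subshift.perfectSpace_of_unbounded _ hmin hX, hmin⟩,
    ⟨_, isRepresentationOf_exampleSubshift ha, card_vertices_le _⟩, ?_⟩
  rintro d ⟨B, hB, hd⟩
  by_contra hlt
  obtain ⟨K, hK⟩ := hB.complexity_le fun n => (hd n).trans (by omega)
  obtain ⟨l, hl⟩ := hX K
  exact absurd (hK l) (not_le.2 hl)

/-! ### Lower bound for the complexity -/

theorem wordsOfLength_exampleSubshift (ha : ∀ n, 2 ≤ a n) (l : ℕ) :
    (exampleSubshift a).wordsOfLength l = {w | w ∈ exampleLanguage a ∧ w.length = l} := by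
  ext w
  constructor
  · rintro ⟨x, hx, m, rfl⟩
    exact ⟨(mem_exampleSubshift_iff ha).1 hx m l, length_factorAt _ _ _⟩
  · rintro ⟨hw, rfl⟩
    obtain ⟨p⟩ := nonempty_pathSpace ha
    obtain ⟨m, hm⟩ := exists_factorAt_eq ha (codePoint ha p).2 hw
    exact ⟨_, (codePoint ha p).2, m, hm.symm⟩

theorem Subshift.finite_wordsOfLength (X : Subshift (Fin 2)) (l : ℕ) :
    (X.wordsOfLength l).Finite := by
  refine (List.finite_length_eq (Fin 2) l).subset ?_
  rintro _ ⟨x, -, m, rfl⟩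
  exact length_factorAt x m l

/-- The complexity increases by at least the number of left special words. -/
theorem Subshift.complexity_add_card_le (X : Subshift (Fin 2)) (l : ℕ) (s : Finset (List (Fin 2)))
    (hs : ∀ w ∈ s, ∀ b : Fin 2, b :: w ∈ X.wordsOfLength (l + 1)) :
    X.complexity l + s.card ≤ X.complexity (l + 1) := by
  -- Every word of length `l` extends to the left, so `A 0 ∪ A 1` contains them all, and the
  -- elements of `A 0 ∩ A 1` are counted twice among the words of length `l + 1`.
  let A : Fin 2 → Set (List (Fin 2)) := fun b => {w | b :: w ∈ X.wordsOfLength (l + 1)}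
  have hfin : ∀ b, (A b).Finite := fun b =>
    (X.finite_wordsOfLength (l + 1)).preimage (List.cons_injective.injOn)
  have h1 : X.wordsOfLength l ⊆ A 0 ∪ A 1 := by
    rintro _ ⟨x, hx, m, rfl⟩
    have h : x (m - 1) :: factorAt x m l ∈ X.wordsOfLength (l + 1) := by
      refine ⟨x, hx, m - 1, ?_⟩
      rw [add_comm l 1, factorAt_add]
      simp [factorAt]
    rcases Fin.exists_fin_two.1 ⟨x (m - 1), rfl⟩ with h' | h' <;> rw [h'] at h
    · exact Or.inl h
    · exact Or.inr h
  have h2 : (s : Set (List (Fin 2))) ⊆ A 0 ∩ A 1 := fun w hw => ⟨hs w hw 0, hs w hw 1⟩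
  have h3 : List.cons 0 '' A 0 ∪ List.cons 1 '' A 1 ⊆ X.wordsOfLength (l + 1) := by
    rintro _ (⟨w, hw, rfl⟩ | ⟨w, hw, rfl⟩) <;> exact hw
  have h4 : Disjoint (List.cons 0 '' A 0) (List.cons (1 : Fin 2) '' A 1) := by
    rw [Set.disjoint_left]
    rintro _ ⟨w, -, rfl⟩ ⟨w', -, h⟩
    exact absurd (List.cons.inj h).1 (by decide)
  have h5 := Set.ncard_le_ncard h1 ((hfin 0).union (hfin 1))
  have h6 := Set.ncard_le_ncard h2 ((hfin 0).inter_of_left _)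
  have h7 := Set.ncard_le_ncard h3 (X.finite_wordsOfLength (l + 1))
  rw [Set.ncard_union_eq h4 ((hfin 0).image _) ((hfin 1).image _),
    Set.ncard_image_of_injective _ List.cons_injective,
    Set.ncard_image_of_injective _ List.cons_injective,
    ← Set.ncard_union_add_ncard_inter _ _ (hfin 0) (hfin 1)] at h7
  rw [Set.ncard_coe_finset] at h6
  simp only [Subshift.complexity]
  omega

/-- The `k`-th power of `τ_{[0, n)}(0)`. -/
abbrev zeroPow (a : ℕ → ℕ) (n k : ℕ) : List (Fin 2) :=
  (List.replicate k (levelWord a n 0)).flatten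

theorem zeroPow_add (a : ℕ → ℕ) (n j k : ℕ) :
    zeroPow a n (j + k) = zeroPow a n j ++ zeroPow a n k := by
  rw [zeroPow, List.replicate_add, List.flatten_append]

theorem zeroPow_one (a : ℕ → ℕ) (n : ℕ) : zeroPow a n 1 = levelWord a n 0 := by
  simp [zeroPow]

theorem length_zeroPow (a : ℕ → ℕ) (n k : ℕ) :
    (zeroPow a n k).length = k * (levelWord a n 0).length := by
  simp [zeroPow]

theorem levelWord_succ_one (a : ℕ → ℕ) (n : ℕ) : levelWord a (n + 1) 1 =
    (List.range' 2 (a n - 1)).flatMap fun j => zeroPow a n j ++ levelWord a n 1 := by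
  rw [levelWord_succ, exampleMorphism_one, List.flatMap_assoc]
  refine List.flatMap_congr fun j _ => ?_
  rw [List.flatMap_append, List.flatMap_singleton, List.flatMap_replicate]

/-- These four blocks show `0^k 1 0^(k+1)` (at level `n`) after a `1`, starting from the second
block, and after a `0`, inside `0^(k+1) 1 0^(k+2)`. -/
theorem four_blocks_infix {n k : ℕ} (hk : 3 ≤ k) (hka : k + 2 ≤ a n) :
    zeroPow a n (k - 1) ++ levelWord a n 1 ++ (zeroPow a n k ++ levelWord a n 1 ++
      (zeroPow a n (k + 1) ++ levelWord a n 1 ++ (zeroPow a n (k + 2) ++ levelWord a n 1)))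
      <:+: levelWord a (n + 1) 1 := by
  obtain ⟨s, rfl⟩ := Nat.exists_eq_add_of_le' hk
  obtain ⟨t, ht⟩ := Nat.exists_eq_add_of_le hka
  have h1 : List.range' 2 (a n - 1) =
      List.range' 2 s ++ (List.range' (2 + s) 4 ++ List.range' (2 + s + 4) t) := by
    rw [List.range'_append_1, List.range'_append_1]
    congr 1
    omega
  rw [levelWord_succ_one, h1, List.flatMap_append, List.flatMap_append]
  have h2 : (List.range' (2 + s) 4).flatMap (fun j => zeroPow a n j ++ levelWord a n 1) =
      zeroPow a n (s + 3 - 1) ++ levelWord a n 1 ++ (zeroPow a n (s + 3) ++ levelWord a n 1 ++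
      (zeroPow a n (s + 3 + 1) ++ levelWord a n 1 ++
        (zeroPow a n (s + 3 + 2) ++ levelWord a n 1))) := by
    rw [show s + 3 - 1 = 2 + s by omega, show s + 3 = 2 + s + 1 by omega]
    simp [List.range'_succ]
  rw [h2]
  exact List.infix_append' _ _ _

/-- The images end with `11` and `01`: the common suffix grows by `levelWord a n 1` on the right,
and the letters just before it trade places. -/
theorem exists_common_suffix (ha : ∀ n, 2 ≤ a n) (n : ℕ) : ∃ c u v x y, x ≠ y ∧
    levelWord a n 0 = u ++ x :: c ∧ levelWord a n 1 = v ++ y :: c := by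
  induction n with
  | zero => exact ⟨[], [], [], 0, 1, by decide, rfl, rfl⟩
  | succ n ih =>
    obtain ⟨c, u, v, x, y, hxy, hu, hv⟩ := ih
    refine ⟨c ++ levelWord a n 1, levelWord a n 0 ++ v, ?_, y, x, hxy.symm, ?_, ?_⟩
    · exact ((List.range' 2 (a n - 2)).flatMap fun j => zeroPow a n j ++ levelWord a n 1) ++
        (zeroPow a n (a n - 1) ++ u)
    · rw [levelWord_succ_zero]
      conv_lhs => enter [2, 1]; rw [hv]
      simp
    · have hk := ha n
      rw [levelWord_succ_one, show a n - 1 = a n - 2 + 1 by omega, List.range'_concat,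
        List.flatMap_append, List.flatMap_singleton,
        show 2 + 1 * (a n - 2) = a n - 2 + 1 + 1 by omega, zeroPow_add _ _ _ 1, zeroPow_one]
      conv_lhs => enter [2, 1, 2]; rw [hu]
      simp

/-- The images begin with `01` and `00`: the common prefix grows by `levelWord a n 0` on the left,
and the first differing letters trade places. -/
theorem exists_common_prefix (ha : ∀ n, 2 ≤ a n) (n : ℕ) : ∃ d u v x y, x ≠ y ∧
    levelWord a n 0 = d ++ x :: u ∧ levelWord a n 1 = d ++ y :: v := by
  induction n with
  | zero => exact ⟨[], [], [], 0, 1, by decide, rfl, rfl⟩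
  | succ n ih =>
    obtain ⟨d, u, v, x, y, hxy, hu, hv⟩ := ih
    obtain ⟨t, ht⟩ := exists_levelWord_one_succ ha n
    refine ⟨levelWord a n 0 ++ d, v ++ levelWord a n 1, u ++ (levelWord a n 1 ++ t), y, x,
      hxy.symm, ?_, ?_⟩
    · rw [levelWord_succ_zero]
      conv_lhs => enter [2, 1]; rw [hv]
      simp
    · rw [ht]
      conv_lhs => enter [2, 1]; rw [hu]
      simp

theorem cons_append_mem {u v c z : List (Fin 2)} {x y : Fin 2} (hxy : x ≠ y)
    (hu : u ++ x :: c ++ z ∈ exampleLanguage a) (hv : v ++ y :: c ++ z ∈ exampleLanguage a)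
    (b : Fin 2) : b :: (c ++ z) ∈ exampleLanguage a := by
  have h1 : x :: (c ++ z) ∈ exampleLanguage a :=
    mem_exampleLanguage_of_infix hu ⟨u, [], by simp⟩
  have h2 : y :: (c ++ z) ∈ exampleLanguage a :=
    mem_exampleLanguage_of_infix hv ⟨v, [], by simp⟩
  have h3 : b = x ∨ b = y := by omega
  rcases h3 with rfl | rfl
  · exact h1
  · exact h2

theorem zero_append_mem (ha : ∀ n, 2 ≤ a n) {n k : ℕ} (hk : 3 ≤ k) (hka : k + 2 ≤ a n) :
    levelWord a n 0 ++ (zeroPow a n k ++ levelWord a n 1 ++ zeroPow a n (k + 1)) ∈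
      exampleLanguage a := by
  refine mem_exampleLanguage_of_levelWord ha
    (List.IsInfix.trans ?_ (four_blocks_infix hk hka))
  rw [show k + 2 = k + 1 + 1 by ring, zeroPow_add a n (k + 1) 1, zeroPow_one]
  refine ⟨zeroPow a n (k - 1) ++ levelWord a n 1 ++ (zeroPow a n k ++ levelWord a n 1),
    levelWord a n 0 ++ levelWord a n 1, ?_⟩
  have h : levelWord a n 0 ++ zeroPow a n k = zeroPow a n (k + 1) := by
    rw [add_comm, zeroPow_add, zeroPow_one]
  rw [← List.append_assoc (levelWord a n 0), ← List.append_assoc (levelWord a n 0), h]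
  simp only [List.append_assoc]

theorem one_append_mem (ha : ∀ n, 2 ≤ a n) {n k : ℕ} (hk : 3 ≤ k) (hka : k + 2 ≤ a n) :
    levelWord a n 1 ++ (zeroPow a n k ++ levelWord a n 1 ++ zeroPow a n (k + 1)) ∈
      exampleLanguage a := by
  refine mem_exampleLanguage_of_levelWord ha
    (List.IsInfix.trans ?_ (four_blocks_infix hk hka))
  exact ⟨zeroPow a n (k - 1), levelWord a n 1 ++ (zeroPow a n (k + 2) ++ levelWord a n 1), by
    simp only [List.append_assoc]⟩

/-- With `m = l / q`, the left special words are the prefixes of length `l` of `c w_n(0)^k w_n(1)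
w_n(0)^(k+1)` for `(m+1)/2 ≤ k ≤ m - 2`. The lower limit makes these words long enough, the upper
one makes their prefixes distinct, and the interval has `m / 2 - 1` elements. -/
theorem complexity_succ_ge (ha : ∀ n, 2 ≤ a n) (n l : ℕ)
    (h6 : 6 ≤ l / (levelWord a n 0).length) (hla : l / (levelWord a n 0).length ≤ a n) :
    (exampleSubshift a).complexity l + (l / (levelWord a n 0).length / 2 - 1) ≤
      (exampleSubshift a).complexity (l + 1) := by
  classical
  obtain ⟨c, u, v, x, y, hxy, hu, hv⟩ := exists_common_suffix ha n
  obtain ⟨d, u', v', x', y', hxy', hu', hv'⟩ := exists_common_prefix ha n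
  have hq0 : 0 < (levelWord a n 0).length := (Nat.zero_le n).trans_lt (lt_length_levelWord ha n 0)
  have hc : c.length < (levelWord a n 0).length := by rw [hu]; simp; omega
  have hd : d.length < (levelWord a n 0).length := by rw [hu']; simp
  set q := (levelWord a n 0).length with hq
  set m := l / q
  have hm1 : m * q ≤ l := Nat.div_mul_le_self l q
  have hm2 : l < (m + 1) * q := (Nat.div_lt_iff_lt_mul hq0).1 (Nat.lt_succ_self m)
  let z : ℕ → List (Fin 2) := fun k =>
    c ++ (zeroPow a n k ++ levelWord a n 1 ++ zeroPow a n (k + 1))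
  have hinj : Set.InjOn (fun k => (z k).take l) (Finset.Icc ((m + 1) / 2) (m - 2)) := by
    have key : ∀ k k', k < k' → k + 2 ≤ m → (z k).take l ≠ (z k').take l := by
      intro k k' hkk hkm h
      obtain ⟨t, rfl⟩ := Nat.exists_eq_add_of_lt hkk
      have h1 : z k = (c ++ zeroPow a n k ++ d) ++ y' :: (v' ++ zeroPow a n (k + 1)) := by
        simp only [z]
        rw [hv']
        simp only [List.append_assoc, List.cons_append]
      have h2 : z (k + t + 1) = (c ++ zeroPow a n k ++ d) ++ x' :: (u' ++ (zeroPow a n t ++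
          levelWord a n 1 ++ zeroPow a n (k + t + 1 + 1))) := by
        simp only [z]
        rw [show k + t + 1 = k + (1 + t) by ring, zeroPow_add a n k, zeroPow_add a n 1 t,
          zeroPow_one]
        conv_lhs => enter [2, 1, 1, 2, 1]; rw [hu']
        simp only [List.append_assoc, List.cons_append]
      set i := (c ++ zeroPow a n k ++ d).length with hi
      -- The first difference comes after `c`, the power and `d`, where `c` and `d` are shorter than
      -- `q`; so `i < (k + 2) q ≤ m q ≤ l`.
      have hil : i < l := by
        rw [hi, List.length_append, List.length_append, length_zeroPow, ← hq]
        have : (k + 2) * q ≤ m * q := Nat.mul_le_mul_right q hkm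
        nlinarith
      have h3 := congrArg (fun w => w[i]?) h
      simp only [List.getElem?_take, hil, if_true] at h3
      rw [h1, h2, List.getElem?_append_right hi.ge, List.getElem?_append_right hi.ge] at h3
      simp [hi] at h3
      exact hxy' h3.symm
    intro k hk k' hk' h
    simp only [Finset.coe_Icc, Set.mem_Icc] at hk hk'
    rcases lt_trichotomy k k' with hlt | heq | hlt
    · exact absurd h (key k k' hlt (by omega))
    · exact heq
    · exact absurd h.symm (key k' k hlt (by omega))
  have hcard := (exampleSubshift a).complexity_add_card_le l
    ((Finset.Icc ((m + 1) / 2) (m - 2)).image fun k => (z k).take l) ?_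
  · rw [Finset.card_image_of_injOn hinj, Nat.card_Icc] at hcard
    omega
  · intro w hw b
    obtain ⟨k, hk, rfl⟩ := Finset.mem_image.1 hw
    rw [Finset.mem_Icc] at hk
    rw [wordsOfLength_exampleSubshift ha]
    have hmem : b :: z k ∈ exampleLanguage a := by
      refine cons_append_mem (u := u) (v := v) hxy ?_ ?_ b
      · rw [← hu]
        exact zero_append_mem ha (by omega) (by omega)
      · rw [← hv]
        exact one_append_mem ha (by omega) (by omega)
    refine ⟨mem_exampleLanguage_of_infix hmem ?_, ?_⟩
    · exact (List.cons_prefix_cons.2 ⟨rfl, List.take_prefix l (z k)⟩).isInfix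
    · rw [List.length_cons, List.length_take, min_eq_left]
      simp only [z, List.length_append, length_zeroPow]
      have h1 : (m + 1) * q ≤ (2 * k + 1) * q := Nat.mul_le_mul_right q (by omega)
      rw [← hq]
      nlinarith

/-! ### Upper bound for the complexity -/

/-- Collect the leading copies of `levelWord a n 0`; the first copy of `levelWord a n 1` is long
enough to reach the end of `p`. Exponents beyond `L` can be cut to `L`, because the power alone then
covers `p`. -/
theorem exists_prefix_zeroPow {n L : ℕ} {y p : List (Fin 2)}
    (hp : p <+: y.flatMap (levelWord a n)) (hv : p.length ≤ (levelWord a n 1).length)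
    (hL : p.length ≤ L * (levelWord a n 0).length) :
    ∃ k ≤ L, p <+: zeroPow a n k ++ levelWord a n 1 := by
  have h1 : ∀ y : List (Fin 2), p <+: y.flatMap (levelWord a n) →
      ∃ k, p <+: zeroPow a n k ++ levelWord a n 1 := by
    intro y hp
    have key : ∀ (y : List (Fin 2)) (j : ℕ), p <+: zeroPow a n j ++ y.flatMap (levelWord a n) →
        ∃ k, p <+: zeroPow a n k ++ levelWord a n 1 := by
      intro y
      induction y with
      | nil =>
        intro j hj
        rw [List.flatMap_nil, List.append_nil] at hj
        exact ⟨j, hj.trans (List.prefix_append _ _)⟩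
      | cons b y ih =>
        intro j hj
        rw [List.flatMap_cons, ← List.append_assoc] at hj
        rcases Fin.exists_fin_two.1 ⟨b, rfl⟩ with rfl | rfl
        · rw [← zeroPow_one a n, ← zeroPow_add] at hj
          exact ih (j + 1) hj
        · refine ⟨j, List.prefix_of_prefix_length_le hj (List.prefix_append _ _) ?_⟩
          rw [List.length_append]
          omega
    exact key y 0 (by simpa [zeroPow] using hp)
  obtain ⟨k, hk⟩ := h1 y hp
  rcases le_total k L with h | h
  · exact ⟨k, h, hk⟩
  · refine ⟨L, le_rfl, ?_⟩
    obtain ⟨t, rfl⟩ := Nat.exists_eq_add_of_le h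
    rw [zeroPow_add, List.append_assoc] at hk
    have := List.prefix_of_prefix_length_le hk (List.prefix_append _ _)
      (by rwa [length_zeroPow])
    exact this.trans (List.prefix_append _ _)

/-- A word not longer than `τ_{[0, n)}(1)` meets at most two occurrences of it. -/
theorem exists_infix_one_zeroPow_one {n L : ℕ} {y w : List (Fin 2)}
    (hw : w <:+: y.flatMap (levelWord a n)) (hv : w.length ≤ (levelWord a n 1).length)
    (hL : w.length ≤ L * (levelWord a n 0).length) :
    ∃ k ≤ L + 1, w <:+: levelWord a n 1 ++ (zeroPow a n k ++ levelWord a n 1) := by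
  induction y with
  | nil =>
    rw [List.flatMap_nil, List.infix_nil] at hw
    exact ⟨0, Nat.zero_le _, hw ▸ List.nil_infix⟩
  | cons b y ih =>
    rw [List.flatMap_cons, List.infix_append_iff] at hw
    rcases hw with h | h | ⟨s, p, rfl, hs, hp⟩
    · rcases Fin.exists_fin_two.1 ⟨b, rfl⟩ with rfl | rfl
      · refine ⟨1, by omega, h.trans ?_⟩
        rw [zeroPow_one]
        exact List.infix_append' _ _ _
      · exact ⟨0, Nat.zero_le _, h.trans (List.prefix_append _ _).isInfix⟩
    · exact ih h
    · rw [List.length_append] at hv hL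
      obtain ⟨k, hk, h⟩ := exists_prefix_zeroPow hp (by omega) (L := L) (by omega)
      obtain ⟨s', hs⟩ := hs
      obtain ⟨p', hp⟩ := h
      rcases Fin.exists_fin_two.1 ⟨b, rfl⟩ with rfl | rfl
      -- The block containing `s` is itself a copy of `levelWord a n 0`, which accounts for the
      -- extra `1` in the bound on the exponent.
      · refine ⟨1 + k, by omega, levelWord a n 1 ++ s', p', ?_⟩
        rw [zeroPow_add, zeroPow_one, List.append_assoc (levelWord a n 0), ← hp, ← hs]
        simp only [List.append_assoc]
      · refine ⟨k, by omega, s', p', ?_⟩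
        rw [← hp]
        conv_rhs => rw [← hs]
        simp only [List.append_assoc]

theorem ncard_infix_le {α : Type*} (T : List α) (l : ℕ) :
    {w : List α | w <:+: T ∧ w.length = l}.Finite ∧
      {w : List α | w <:+: T ∧ w.length = l}.ncard ≤ T.length + 1 := by
  classical
  have h : {w : List α | w <:+: T ∧ w.length = l} ⊆
      ((Finset.range (T.length + 1)).image fun i => (T.drop i).take l : Finset (List α)) := by
    rintro w ⟨⟨s, t, rfl⟩, rfl⟩
    rw [Finset.mem_coe, Finset.mem_image]
    refine ⟨s.length, Finset.mem_range.2 (by simp), ?_⟩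
    simp
  refine ⟨(Finset.finite_toSet _).subset h, (Set.ncard_le_ncard h (Finset.finite_toSet _)).trans ?_⟩
  rw [Set.ncard_coe_finset]
  exact Finset.card_image_le.trans (Finset.card_range _).le

/-- The exponent takes at most `l / q + 3` values, and each host word contributes at most one factor
per starting position. -/
theorem complexity_le (ha : ∀ n, 2 ≤ a n) (n l : ℕ) (hl : l ≤ (levelWord a n 1).length) :
    (exampleSubshift a).complexity l ≤ (l / (levelWord a n 0).length + 3) *
      (2 * (levelWord a n 1).length + l + 2 * (levelWord a n 0).length + 1) := by
  have hq0 : 0 < (levelWord a n 0).length := (Nat.zero_le n).trans_lt (lt_length_levelWord ha n 0)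
  set q := (levelWord a n 0).length with hq
  set r := (levelWord a n 1).length with hr
  set L := l / q + 1 with hL
  have hlL : l ≤ L * q := ((Nat.div_lt_iff_lt_mul hq0).1 (Nat.lt_succ_self _)).le
  have hLl : (L + 1) * q ≤ l + 2 * q := by
    have := Nat.div_mul_le_self l q
    rw [hL]
    nlinarith
  let T : ℕ → List (Fin 2) := fun k => levelWord a n 1 ++ (zeroPow a n k ++ levelWord a n 1)
  have hsub : (exampleSubshift a).wordsOfLength l ⊆
      ⋃ k ∈ Finset.range (L + 2), {w | w <:+: T k ∧ w.length = l} := by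
    intro w hw
    rw [wordsOfLength_exampleSubshift ha] at hw
    obtain ⟨hw, hwl⟩ := hw
    obtain ⟨y, hy⟩ := mem_exampleLanguage_iff_flatMap ha n hw
    obtain ⟨k, hk, h⟩ := exists_infix_one_zeroPow_one hy (by rw [hwl]; exact hl) (L := L)
      (by rw [hwl]; exact hlL)
    exact Set.mem_biUnion (Finset.mem_range.2 (by omega)) ⟨h, hwl⟩
  refine (Set.ncard_le_ncard hsub
    ((Finset.range (L + 2)).finite_toSet.biUnion fun k _ => (ncard_infix_le _ l).1)).trans ?_
  refine (Finset.set_ncard_biUnion_le _ _).trans ?_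
  refine (Finset.sum_le_card_nsmul _ _ (2 * r + l + 2 * q + 1) fun k hk => ?_).trans ?_
  · refine (ncard_infix_le _ l).2.trans ?_
    simp only [T, List.length_append, length_zeroPow]
    have h1 : k * q ≤ (L + 1) * q :=
      Nat.mul_le_mul_right q (Nat.lt_succ_iff.1 (Finset.mem_range.1 hk))
    rw [← hq, ← hr]
    omega
  · rw [Finset.card_range, smul_eq_mul]

/-! ### The choice of the sequence -/

/-- The sequence `a` together with the lengths of `τ_{[0, n)}(0)` and `τ_{[0, n)}(1)`. -/
def exampleData : ℕ → ℕ × ℕ × ℕ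
  -- Starting at `3` rather than `2` gives `a n - 1 ≥ 2` throughout, which is convenient in
  -- `lengthZero_le_lengthOne`.
  | 0 => (3, 1, 1)
  | n + 1 =>
    let A := (exampleData n).1
    let q := (exampleData n).2.1
    let r := (exampleData n).2.2
    let r' := (List.range' 2 (A - 1)).sum * q + (A - 1) * r
    -- The `1` makes the growth inequality strict despite rounding down, and `A` makes the sequence
    -- increase. Nothing more is added, so that `exampleSeq_mul_le` holds.
    (A + 1 + (3 * n + 4) * r' / (q + 2 * r), q + 2 * r, r')

/-- The sequence `a` of the example. -/
def exampleSeq (n : ℕ) : ℕ := (exampleData n).1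

/-- The length of `τ_{[0, n)}(0)`. -/
def lengthZero (n : ℕ) : ℕ := (exampleData n).2.1

/-- The length of `τ_{[0, n)}(1)`. -/
def lengthOne (n : ℕ) : ℕ := (exampleData n).2.2

theorem lengthZero_succ (n : ℕ) : lengthZero (n + 1) = lengthZero n + 2 * lengthOne n := rfl

theorem lengthOne_succ (n : ℕ) : lengthOne (n + 1) =
    (List.range' 2 (exampleSeq n - 1)).sum * lengthZero n + (exampleSeq n - 1) * lengthOne n := rfl

theorem exampleSeq_succ (n : ℕ) : exampleSeq (n + 1) =
    exampleSeq n + 1 + (3 * n + 4) * lengthOne (n + 1) / lengthZero (n + 1) := rfl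

theorem length_flatMap_zeroPow (a : ℕ → ℕ) (n : ℕ) (l : List ℕ) :
    (l.flatMap fun j => zeroPow a n j ++ levelWord a n 1).length =
      l.sum * (levelWord a n 0).length + l.length * (levelWord a n 1).length := by
  induction l with
  | nil => simp
  | cons j l ih =>
    rw [List.flatMap_cons, List.length_append, ih, List.length_append, length_zeroPow,
      List.sum_cons, List.length_cons]
    ring

theorem length_levelWord_exampleSeq (n : ℕ) : (levelWord exampleSeq n 0).length = lengthZero n ∧
    (levelWord exampleSeq n 1).length = lengthOne n := by
  induction n with
  | zero => exact ⟨rfl, rfl⟩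
  | succ n ih =>
    constructor
    · rw [levelWord_succ_zero, List.length_append, List.length_append, ih.1, ih.2,
        lengthZero_succ]
      ring
    · rw [levelWord_succ_one, length_flatMap_zeroPow, ih.1, ih.2, List.length_range',
        lengthOne_succ]

theorem strictMono_exampleSeq : StrictMono exampleSeq :=
  strictMono_nat_of_lt_succ fun n => by
    rw [exampleSeq_succ, add_assoc]
    exact Nat.lt_add_of_pos_right (Nat.add_pos_left Nat.one_pos _)

theorem three_le_exampleSeq (n : ℕ) : 3 ≤ exampleSeq n :=
  strictMono_exampleSeq.monotone (Nat.zero_le n)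

theorem two_le_exampleSeq (n : ℕ) : 2 ≤ exampleSeq n := by
  have := three_le_exampleSeq n
  omega

theorem lengthZero_pos (n : ℕ) : 0 < lengthZero n := by
  rw [← (length_levelWord_exampleSeq n).1]
  exact (Nat.zero_le n).trans_lt (lt_length_levelWord two_le_exampleSeq n 0)

theorem self_le_lengthOne (n : ℕ) : n ≤ lengthOne n := by
  rw [← (length_levelWord_exampleSeq n).2]
  exact (lt_length_levelWord two_le_exampleSeq n 1).le

theorem lt_exampleSeq_mul (n : ℕ) :
    (3 * n + 4) * lengthOne (n + 1) < exampleSeq (n + 1) * lengthZero (n + 1) := by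
  rw [← Nat.div_lt_iff_lt_mul (lengthZero_pos _), exampleSeq_succ]
  omega

theorem le_sum_range' {A : ℕ} (hA : 2 ≤ A) : A ≤ (List.range' 2 (A - 1)).sum :=
  List.single_le_sum (by simp) A (List.mem_range'_1.2 ⟨hA, by omega⟩)

theorem sum_range'_le (A : ℕ) : (List.range' 2 (A - 1)).sum ≤ A * A := by
  have h := List.sum_le_card_nsmul (List.range' 2 (A - 1)) A fun x hx => by
    have := List.mem_range'_1.1 hx
    omega
  rw [List.length_range', smul_eq_mul] at h
  exact h.trans (Nat.mul_le_mul_right A (by omega))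

theorem lengthOne_succ_ge (n : ℕ) : exampleSeq n * lengthZero n +
    (exampleSeq n - 1) * lengthOne n ≤ lengthOne (n + 1) := by
  rw [lengthOne_succ]
  exact Nat.add_le_add_right (Nat.mul_le_mul_right _ (le_sum_range' (two_le_exampleSeq n))) _

theorem lengthOne_succ_le (n : ℕ) : lengthOne (n + 1) ≤
    exampleSeq n * exampleSeq n * lengthZero n + exampleSeq n * lengthOne n := by
  rw [lengthOne_succ]
  exact Nat.add_le_add (Nat.mul_le_mul_right _ (sum_range'_le _))
    (Nat.mul_le_mul_right _ (by omega))

theorem lengthZero_le_lengthOne (n : ℕ) : lengthZero n ≤ lengthOne n := by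
  cases n with
  | zero => exact le_rfl
  | succ n =>
    refine le_trans ?_ (lengthOne_succ_ge n)
    have h := three_le_exampleSeq n
    rw [lengthZero_succ]
    refine Nat.add_le_add (Nat.le_mul_of_pos_left _ (by omega)) ?_
    exact Nat.mul_le_mul_right _ (by omega)

/-- The quotient contributes at most `(3n+4) r_(n+1)` at index `n + 1`, and the summand `a_n + 1` at
most `8 r_(n+1)`, since `r_(n+1)` itself grows in proportion to `a_n`. The total coefficient is
`3(n+1) + 9`. -/
theorem exampleSeq_mul_le (n : ℕ) :
    exampleSeq n * lengthZero n ≤ (3 * n + 9) * lengthOne n := by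
  cases n with
  | zero => decide
  | succ n =>
    have h1 := lengthOne_succ_ge n
    have h2 : (3 * n + 4) * lengthOne (n + 1) / lengthZero (n + 1) * lengthZero (n + 1) ≤
      (3 * n + 4) * lengthOne (n + 1) := Nat.div_mul_le_self _ _
    obtain ⟨b, hb⟩ := Nat.exists_eq_add_of_le (three_le_exampleSeq n)
    rw [hb, show 3 + b - 1 = b + 2 by omega] at h1
    rw [exampleSeq_succ, add_mul, hb]
    have h3 : (3 + b + 1) * lengthZero (n + 1) ≤ 8 * lengthOne (n + 1) := by
      rw [lengthZero_succ]
      nlinarith [Nat.zero_le (b * lengthZero n), Nat.zero_le (b * lengthOne n)]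
    nlinarith

theorem three_pow_le_lengthZero (n : ℕ) : 3 ^ n ≤ lengthZero n := by
  induction n with
  | zero => exact le_rfl
  | succ n ih =>
    have := lengthZero_le_lengthOne n
    rw [lengthZero_succ, pow_succ]
    omega

/-- From `r_(n+1) ≤ a_n² q_n + a_n r_n`, multiplication by `q_n` leaves only powers of `a_n q_n` and
`r_n`, and the former is at most `(3n+9) r_n`. -/
theorem lengthZero_mul_lengthOne_succ_le (n : ℕ) :
    lengthZero n * lengthOne (n + 1) ≤ 2 * (3 * n + 9) ^ 2 * lengthOne n ^ 2 := by
  have h1 := lengthOne_succ_le n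
  have h2 := exampleSeq_mul_le n
  have h3 := Nat.mul_le_mul_left (lengthZero n) h1
  have h4 : (exampleSeq n * lengthZero n) * (exampleSeq n * lengthZero n) ≤
      (3 * n + 9) * lengthOne n * ((3 * n + 9) * lengthOne n) := Nat.mul_le_mul h2 h2
  have h5 : (exampleSeq n * lengthZero n) * lengthOne n ≤
      (3 * n + 9) * lengthOne n * lengthOne n := Nat.mul_le_mul_right _ h2
  have h6 : (3 * n + 9) * lengthOne n * lengthOne n ≤
      (3 * n + 9) * ((3 * n + 9) * lengthOne n * lengthOne n) :=
    Nat.le_mul_of_pos_left _ (by omega)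
  nlinarith

/-! ### Asymptotics of the complexity -/

theorem exists_lt_and_le_succ {f : ℕ → ℕ} (hf : ∀ n, n ≤ f n) {m l : ℕ} (h : f m < l) :
    ∃ n ≥ m, f n < l ∧ l ≤ f (n + 1) := by
  classical
  have hex : ∃ k, l ≤ f (m + k) := ⟨l, (Nat.le_add_left l m).trans (hf _)⟩
  obtain ⟨k, hk⟩ : ∃ k, Nat.find hex = k + 1 := by
    refine Nat.exists_eq_succ_of_ne_zero fun h0 => ?_
    have := Nat.find_spec hex
    rw [h0] at this
    exact absurd this (not_le.2 h)
  refine ⟨m + k, by omega, not_le.1 (Nat.find_min hex (by omega)), ?_⟩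
  have := Nat.find_spec hex
  rwa [hk] at this

/-- The complexity of the example eventually increases by at least `M` at each step. -/
theorem eventually_complexity_succ_ge (M : ℕ) : ∃ l₀, ∀ l ≥ l₀,
    (exampleSubshift exampleSeq).complexity l + M ≤
      (exampleSubshift exampleSeq).complexity (l + 1) := by
  have hf : ∀ n, n ≤ exampleSeq n * lengthZero n := fun n =>
    (strictMono_exampleSeq.id_le n).trans (Nat.le_mul_of_pos_right _ (lengthZero_pos n))
  refine ⟨exampleSeq (2 * M + 6) * lengthZero (2 * M + 6) + 1, fun l hl => ?_⟩
  obtain ⟨n, hn, h1, h2⟩ := exists_lt_and_le_succ hf (Nat.lt_of_succ_le hl)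
  obtain ⟨k, rfl⟩ := Nat.exists_eq_succ_of_ne_zero (show n ≠ 0 by omega)
  have h3 := complexity_succ_ge two_le_exampleSeq (k + 1 + 1) l
  rw [(length_levelWord_exampleSeq _).1] at h3
  -- This is where the factor `3n + 4` matters: `(k+1)(q_(k+1) + 2 r_(k+1)) ≤ 3(k+1) r_(k+1) ≤
  -- (3k+4) r_(k+1) < a_(k+1) q_(k+1) < l`.
  have h4 : k + 1 ≤ l / lengthZero (k + 1 + 1) := by
    rw [Nat.le_div_iff_mul_le (lengthZero_pos _), lengthZero_succ]
    have h5 := lt_exampleSeq_mul k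
    have h6 := lengthZero_le_lengthOne (k + 1)
    rw [Nat.succ_eq_add_one] at h1
    nlinarith
  have h7 : l / lengthZero (k + 1 + 1) ≤ exampleSeq (k + 1 + 1) :=
    Nat.div_le_of_le_mul (by rwa [mul_comm])
  have h8 := h3 (by omega) h7
  omega

theorem eventually_mul_le_complexity (M : ℕ) : ∃ l₀, ∀ l ≥ l₀,
    M * l ≤ (exampleSubshift exampleSeq).complexity l := by
  -- Slope `2 * M` from `l₀` on gives slope `M` from the origin once `l ≥ 2 * l₀`.
  obtain ⟨l₀, h⟩ := eventually_complexity_succ_ge (2 * M)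
  have h1 : ∀ j, 2 * M * j ≤ (exampleSubshift exampleSeq).complexity (l₀ + j) := by
    intro j
    induction j with
    | zero => exact Nat.zero_le _
    | succ j ih =>
      have := h (l₀ + j) (by omega)
      rw [add_assoc] at this
      rw [mul_add, mul_one]
      omega
  refine ⟨2 * l₀, fun l hl => ?_⟩
  obtain ⟨j, rfl⟩ := Nat.exists_eq_add_of_le (show l₀ ≤ l by omega)
  refine le_trans ?_ (h1 j)
  rw [mul_comm 2 M, mul_assoc]
  exact Nat.mul_le_mul_left M (by omega)

theorem liminf_complexity_div :
    liminf (fun n : ℕ => ((exampleSubshift exampleSeq).complexity n : ℝ≥0∞) / (n : ℝ≥0∞)) atTop =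
      ⊤ := by
  refine Tendsto.liminf_eq (ENNReal.tendsto_nhds_top fun M => ?_)
  obtain ⟨l₀, h⟩ := eventually_mul_le_complexity (M + 1)
  filter_upwards [eventually_ge_atTop l₀, eventually_gt_atTop 0] with l hl hl0
  refine lt_of_lt_of_le (b := ((M + 1 : ℕ) : ℝ≥0∞)) (by exact_mod_cast M.lt_succ_self) ?_
  rw [ENNReal.le_div_iff_mul_le (Or.inl (by exact_mod_cast hl0.ne'))
    (Or.inl (ENNReal.natCast_ne_top l))]
  exact_mod_cast h l hl

/-- Apply `complexity_le` at level `n + 1`. The large term `q_n r_(n+1)` is at most `2 (3n+9)²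
r_n²`; one factor `r_n` cancels against `q_(n+1) ≥ 2 r_n` in `l / q_(n+1)`, and the other is less
than `l`. -/
theorem complexity_mul_le {n l : ℕ} (h1 : lengthOne n < l) (h2 : l ≤ lengthOne (n + 1)) :
    (exampleSubshift exampleSeq).complexity l * lengthZero n ≤ 46 * (3 * n + 9) ^ 2 * l ^ 2 := by
  have hp := complexity_le two_le_exampleSeq (n + 1) l (by rwa [(length_levelWord_exampleSeq _).2])
  rw [(length_levelWord_exampleSeq _).1, (length_levelWord_exampleSeq _).2] at hp
  have hr := lengthZero_mul_lengthOne_succ_le n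
  have hq := lengthZero_le_lengthOne n
  have hQ := lengthZero_succ n
  have hm := Nat.div_mul_le_self l (lengthZero (n + 1))
  set m := l / lengthZero (n + 1)
  set D := (3 * n + 9) ^ 2
  have hD : 1 ≤ D := Nat.one_le_pow _ _ (by omega)
  set q := lengthZero n
  set r := lengthOne n
  set Q := lengthZero (n + 1)
  set R := lengthOne (n + 1)
  have e1 : 2 * R + l + 2 * Q + 1 ≤ 2 * R + 8 * l := by omega
  have e2 : m * q ≤ l := (Nat.mul_le_mul_left m (by omega)).trans hm
  have e3 : m * (2 * r) ≤ l := (Nat.mul_le_mul_left m (by omega)).trans hm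
  have e4 : (m + 3) * q ≤ 4 * l := by
    rw [add_mul]
    omega
  have e5 : (m + 3) * (2 * r) ≤ 7 * l := by
    rw [add_mul]
    omega
  calc (exampleSubshift exampleSeq).complexity l * q
      ≤ (m + 3) * (2 * R + 8 * l) * q :=
        Nat.mul_le_mul_right q (hp.trans (Nat.mul_le_mul_left _ e1))
    _ = 2 * (m + 3) * (q * R) + (m + 3) * q * (8 * l) := by ring
    _ ≤ 2 * (m + 3) * (2 * D * r ^ 2) + 4 * l * (8 * l) :=
        Nat.add_le_add (Nat.mul_le_mul_left _ hr) (Nat.mul_le_mul_right _ e4)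
    _ = (m + 3) * (2 * r) * (2 * D * r) + 32 * l ^ 2 := by ring
    _ ≤ 7 * l * (2 * D * l) + 32 * l ^ 2 :=
        Nat.add_le_add_right (Nat.mul_le_mul e5 (Nat.mul_le_mul_left _ h1.le)) _
    _ = 14 * D * l ^ 2 + 32 * 1 * l ^ 2 := by ring
    _ ≤ 14 * D * l ^ 2 + 32 * D * l ^ 2 :=
        Nat.add_le_add_left (Nat.mul_le_mul_right _ (Nat.mul_le_mul_left _ hD)) _
    _ = 46 * D * l ^ 2 := by ring

theorem tendsto_complexity_div_sq :
    Tendsto (fun n : ℕ => ((exampleSubshift exampleSeq).complexity n : ℝ) / (n : ℝ) ^ 2) atTop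
      (𝓝 0) := by
  have hlim : Tendsto (fun n : ℕ => 46 * (3 * (n : ℝ) + 9) ^ 2 / 3 ^ n) atTop (𝓝 0) := by
    have h0 := tendsto_pow_const_div_const_pow_of_one_lt 0 (show (1 : ℝ) < 3 by norm_num)
    have h1 := tendsto_pow_const_div_const_pow_of_one_lt 1 (show (1 : ℝ) < 3 by norm_num)
    have h2 := tendsto_pow_const_div_const_pow_of_one_lt 2 (show (1 : ℝ) < 3 by norm_num)
    -- These are the coefficients of `46 (3n+9)²`.
    have h := ((h2.const_mul 414).add (h1.const_mul 2484)).add (h0.const_mul 3726)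
    simp only [mul_zero, add_zero] at h
    refine h.congr fun n => ?_
    ring
  rw [Metric.tendsto_atTop]
  intro ε hε
  obtain ⟨m, hm⟩ := eventually_atTop.1 (hlim.eventually (gt_mem_nhds hε))
  refine ⟨lengthOne m + 1, fun l hl => ?_⟩
  obtain ⟨n, hn, h1, h2⟩ := exists_lt_and_le_succ self_le_lengthOne (Nat.lt_of_succ_le hl)
  rw [Real.dist_eq, sub_zero, abs_of_nonneg (by positivity)]
  refine lt_of_le_of_lt ?_ (hm n hn)
  have hl0 : (0 : ℝ) < l := by exact_mod_cast (Nat.zero_le _).trans_lt h1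
  rw [div_le_div_iff₀ (by positivity) (by positivity)]
  have h3 : (exampleSubshift exampleSeq).complexity l * 3 ^ n ≤ 46 * (3 * n + 9) ^ 2 * l ^ 2 :=
    (Nat.mul_le_mul_left _ (three_pow_le_lengthZero n)).trans (complexity_mul_le h1 h2)
  exact_mod_cast h3

theorem mainTheorem10 :
    ∃ a : ℕ → ℕ, StrictMono a ∧ 2 ≤ a 0 ∧
      (∀ n : ℕ,
        (3 * n + 4) * (composedMorphism (A := fun _ => Fin 2) (exampleMorphism a) 0 (n + 1) 1).length
          < a (n + 1) *
            (composedMorphism (A := fun _ => Fin 2) (exampleMorphism a) 0 (n + 1) 0).length) ∧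
      IsMinimalSystem (exampleSubshift a).shift ∧
      HasTopologicalRank (exampleSubshift a).shift 2 ∧
      liminf (fun n : ℕ => ((exampleSubshift a).complexity n : ℝ≥0∞) / (n : ℝ≥0∞)) atTop = ⊤ ∧
      Tendsto (fun n : ℕ => ((exampleSubshift a).complexity n : ℝ) / (n : ℝ) ^ 2) atTop (𝓝 0) := by
  refine ⟨exampleSeq, strictMono_exampleSeq, two_le_exampleSeq 0, fun n => ?_,
    isMinimalSystem_exampleSubshift two_le_exampleSeq,
    hasTopologicalRank_exampleSubshift two_le_exampleSeq fun K => ?_,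
    liminf_complexity_div, tendsto_complexity_div_sq⟩
  · rw [← iterateMorphism_eq_composedMorphism, ← iterateMorphism_eq_composedMorphism,
      (length_levelWord_exampleSeq (n + 1)).1, (length_levelWord_exampleSeq (n + 1)).2]
    exact lt_exampleSeq_mul n
  · obtain ⟨l₀, h⟩ := eventually_mul_le_complexity (K + 1)
    refine ⟨l₀ + 1, lt_of_lt_of_le K.lt_succ_self (le_trans ?_ (h (l₀ + 1) (by omega)))⟩
    exact Nat.le_mul_of_pos_right _ (Nat.succ_pos _)
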